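/- **Setting.** An instance with $n\ge 0$ actions and $m\ge 1$ outcomes consists of costs $c_i\ge 0$, rewards $0=r(1)\le r(2)\le\dots\le r(m)$, and, for each action $i$, a probability distribution $(p_{ij})_{j\in[m]}$ on the outcomes. The outcomes $X_1,\dots,X_n$ of the actions are independent, with $\Pr[X_i=j]=p_{ij}$. Given a contract $t:[m]\to\mathbb{R}_{\ge 0}$, an agent takes actions one at a time; taking action $i$ costs $c_i$ and reveals $X_i$, and no action is taken twice. At each point the agent chooses, depending on everything observed so far, which action to take next or to halt; on halting he selects the final outcome $\omega$ among the revealed outcomes and outcome $1$, which is always available. With $S$ the set of actions taken, a strategy $\pi$ gives the agent the expected utility $u_A(t,\pi)=\mathbb{E}[t(\omega)-\sum_{i\in S}c_i]$ and the principal $u_P(t,\pi)=\mathbb{E}[r(\omega)-t(\omega)]$. The agent's best response is a strategy that maximizes $u_A(t,\cdot)$ and, among those, maximizes $u_P(t,\cdot)$; $u_P(t)$ is the principal's utility under the best response. The linear contract with parameter $\alpha\in[0,1]$ is $t_\alpha(j)=\alpha\, r(j)$; it is optimal if $u_P(t_\alpha)\ge u_P(t_{\alpha'})$ for all $\alpha'\in[0,1]$.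 **Theorem.** In the independent-action model, the optimal linear contract can be computed in time polynomial in $n$ and $m$. Precisely: there are one program for a random access machine (whose real-number operations are $+,-,\times,/$ and comparison, with no real constants other than $0$ and $1$) and constants $C,k\in\mathbb{N}$ such that, for all $n,m$ and every instance, the program, given $n$, $m$, $(c_i)$, $(r(j))$, $(p_{ij})$, halts after at most $C(n+m)^k$ steps and outputs an $\alpha\in[0,1]$ for which $t_\alpha$ is an optimal linear contract. Moreover, for every $L\in\mathbb{N}$, if all numbers of the instance are rational with numerators and denominators of at most $L$ bits, then every number written to the real memory during the run is rational with numerator and denominator of at most $C(n+m+L)^k$ bits. -/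

import Mathlib

namespace SeqContract

/-! ### The principal-agent model with independent actions -/

/-- An instance with `n` independent actions and `m` outcomes.  Outcome `0 : Fin m` is the zero
outcome, which is why `m` is nonzero. -/
structure Instance (n m : ℕ) [NeZero m] where
  cost : Fin n → ℝ
  reward : Fin m → ℝ
  /-- `prob i j` is the probability that action `i` reveals outcome `j`. -/
  prob : Fin n → Fin m → ℝ
  cost_nonneg : ∀ i, 0 ≤ cost i
  reward_nonneg : ∀ j, 0 ≤ reward j
  reward_mono : Monotone reward
  reward_zero : reward 0 = 0
  prob_nonneg : ∀ i j, 0 ≤ prob i j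
  prob_sum : ∀ i, ∑ j, prob i j = 1

/-- A plan of the agent, as a decision tree: either halt and select the final outcome `j`, or take
action `i` and continue depending on the outcome that it reveals. -/
inductive Plan (n m : ℕ) : Type
  | halt (j : Fin m) : Plan n m
  | take (i : Fin n) (next : Fin m → Plan n m) : Plan n m

namespace Plan

variable {n m : ℕ}

/-- The plan is legal after the actions in `taken` have been taken and the outcomes in `revealed`
have been revealed: no action is repeated, and the selected outcome is a revealed one. -/
def Legal : Plan n m → Finset (Fin n) → Finset (Fin m) → Prop
  | halt j, _, revealed => j ∈ revealed
  | take i next, taken, revealed =>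
      i ∉ taken ∧ ∀ j, (next j).Legal (insert i taken) (insert j revealed)

/-- A strategy of the agent: a plan that is legal from the start, when no action has been taken and
only the zero outcome is revealed. -/
def IsStrategy [NeZero m] (π : Plan n m) : Prop := π.Legal ∅ {0}

/-- The final outcome when action `i` reveals `X i`. -/
def finalOutcome (X : Fin n → Fin m) : Plan n m → Fin m
  | halt j => j
  | take i next => (next (X i)).finalOutcome X

/-- The set of actions taken when action `i` reveals `X i`. -/
def actions (X : Fin n → Fin m) : Plan n m → Finset (Fin n)
  | halt _ => ∅
  | take i next => insert i ((next (X i)).actions X)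

end Plan

namespace Instance

variable {n m : ℕ} [NeZero m] (I : Instance n m)

/-- Expectation over independent `X 0, …, X (n - 1)`, where `X i` has distribution `prob i`. -/
def expect (f : (Fin n → Fin m) → ℝ) : ℝ :=
  ∑ X : Fin n → Fin m, (∏ i, I.prob i (X i)) * f X

/-- The agent's utility under the contract `t` and the strategy `π`. -/
def agentUtility (t : Fin m → ℝ) (π : Plan n m) : ℝ :=
  I.expect fun X => t (π.finalOutcome X) - ∑ i ∈ π.actions X, I.cost i

/-- The principal's utility under the contract `t` and the strategy `π`. -/
def principalUtilityOf (t : Fin m → ℝ) (π : Plan n m) : ℝ :=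
  I.expect fun X => I.reward (π.finalOutcome X) - t (π.finalOutcome X)

/-- `π` is a strategy that maximizes the agent's utility under the contract `t`. -/
def AgentOptimal (t : Fin m → ℝ) (π : Plan n m) : Prop :=
  π.IsStrategy ∧ ∀ π' : Plan n m, π'.IsStrategy → I.agentUtility t π' ≤ I.agentUtility t π

/-- `π` maximizes the agent's utility, ties being broken in favor of the principal. -/
def IsBestResponse (t : Fin m → ℝ) (π : Plan n m) : Prop :=
  I.AgentOptimal t π ∧
    ∀ π' : Plan n m, I.AgentOptimal t π' → I.principalUtilityOf t π' ≤ I.principalUtilityOf t π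

theorem exists_isBestResponse (t : Fin m → ℝ) : ∃ π : Plan n m, I.IsBestResponse t π := by
  classical
  let F : Plan n m → (Fin n → Fin m) → Fin m × Finset (Fin n) :=
    fun π X => (π.finalOutcome X, π.actions X)
  let uA : ((Fin n → Fin m) → Fin m × Finset (Fin n)) → ℝ :=
    fun g => I.expect fun X => t (g X).1 - ∑ i ∈ (g X).2, I.cost i
  let uP : ((Fin n → Fin m) → Fin m × Finset (Fin n)) → ℝ :=
    fun g => I.expect fun X => I.reward (g X).1 - t (g X).1
  have h1 : (F '' {π | π.IsStrategy}).Nonempty :=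
    ⟨_, ⟨Plan.halt 0, by simp [Plan.IsStrategy, Plan.Legal], rfl⟩⟩
  obtain ⟨_, ⟨π₁, hπ₁, rfl⟩, hmax₁⟩ := Set.exists_max_image _ uA (Set.toFinite _) h1
  have hopt : I.AgentOptimal t π₁ := ⟨hπ₁, fun π' h => hmax₁ _ ⟨π', h, rfl⟩⟩
  have h2 : (F '' {π | I.AgentOptimal t π}).Nonempty := ⟨_, ⟨π₁, hopt, rfl⟩⟩
  obtain ⟨_, ⟨π₂, hπ₂, rfl⟩, hmax₂⟩ := Set.exists_max_image _ uP (Set.toFinite _) h2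
  exact ⟨π₂, hπ₂, fun π' h => hmax₂ _ ⟨π', h, rfl⟩⟩

/-- The agent's best response to the contract `t`; remaining ties are broken arbitrarily. -/
noncomputable def bestResponse (t : Fin m → ℝ) : Plan n m := (I.exists_isBestResponse t).choose

/-- The principal's utility under the contract `t`, given that the agent best responds. -/
noncomputable def principalUtility (t : Fin m → ℝ) : ℝ := I.principalUtilityOf t (I.bestResponse t)

/-- The linear contract with parameter `α`. -/
def linearContract (α : ℝ) : Fin m → ℝ := fun j => α * I.reward j

/-- `α` is the parameter of an optimal linear contract. -/
def IsOptimalLinear (α : ℝ) : Prop :=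
  α ∈ Set.Icc (0 : ℝ) 1 ∧ ∀ α' ∈ Set.Icc (0 : ℝ) 1,
    I.principalUtility (I.linearContract α') ≤ I.principalUtility (I.linearContract α)

end Instance

/-! ### The machine model: a random access machine over the reals, with a step count

Programs are uniform: one finite text for all sizes of the input.  The machine has natural-number
variables (for counting and addressing; only constants, addition, truncated subtraction and
comparison) and arrays of real cells (the constants `0` and `1`, the four field operations and
comparison; no other constants and no rounding). -/

/-- Index expressions. -/
inductive IExp : Type
  | const (k : ℕ) : IExp
  | var (x : ℕ) : IExp
  | add (e e' : IExp) : IExp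
  | sub (e e' : IExp) : IExp

/-- Arithmetic expressions; `get a i j` reads cell `(i, j)` of array `a`. -/
inductive RExp : Type
  | zero : RExp
  | one : RExp
  | get (a : ℕ) (i j : IExp) : RExp
  | add (e e' : RExp) : RExp
  | sub (e e' : RExp) : RExp
  | mul (e e' : RExp) : RExp
  | div (e e' : RExp) : RExp

/-- Tests. -/
inductive BExp : Type
  | ilt (e e' : IExp) : BExp
  | rlt (e e' : RExp) : BExp
  | not (b : BExp) : BExp
  | and (b b' : BExp) : BExp

/-- Programs. -/
inductive Cmd : Type
  | skip : Cmd
  | iset (x : ℕ) (e : IExp) : Cmd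
  | rset (a : ℕ) (i j : IExp) (e : RExp) : Cmd
  | seq (c c' : Cmd) : Cmd
  | ite (b : BExp) (c c' : Cmd) : Cmd
  | loop (b : BExp) (c : Cmd) : Cmd

/-- A machine state: the index variables and the real arrays. -/
@[ext] structure State where
  idx : ℕ → ℕ
  mem : ℕ → ℕ → ℕ → ℝ

namespace State

def setIdx (s : State) (x v : ℕ) : State where
  idx := fun y => if y = x then v else s.idx y
  mem := s.mem

noncomputable def setMem (s : State) (a i j : ℕ) (v : ℝ) : State where
  idx := s.idx
  mem := fun a' i' j' => if a' = a ∧ i' = i ∧ j' = j then v else s.mem a' i' j'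

end State

namespace IExp

def eval (s : State) : IExp → ℕ
  | const k => k
  | var x => s.idx x
  | add e e' => e.eval s + e'.eval s
  | sub e e' => e.eval s - e'.eval s

/-- The number of operations in the expression. -/
def size : IExp → ℕ
  | const _ => 1
  | var _ => 1
  | add e e' => e.size + e'.size + 1
  | sub e e' => e.size + e'.size + 1

end IExp

namespace RExp

/-- Division by zero returns `0`. -/
noncomputable def eval (s : State) : RExp → ℝ
  | zero => 0
  | one => 1
  | get a i j => s.mem a (i.eval s) (j.eval s)
  | add e e' => e.eval s + e'.eval s
  | sub e e' => e.eval s - e'.eval s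
  | mul e e' => e.eval s * e'.eval s
  | div e e' => e.eval s / e'.eval s

def size : RExp → ℕ
  | zero => 1
  | one => 1
  | get _ i j => i.size + j.size + 1
  | add e e' => e.size + e'.size + 1
  | sub e e' => e.size + e'.size + 1
  | mul e e' => e.size + e'.size + 1
  | div e e' => e.size + e'.size + 1

end RExp

namespace BExp

def Holds (s : State) : BExp → Prop
  | ilt e e' => e.eval s < e'.eval s
  | rlt e e' => e.eval s < e'.eval s
  | not b => ¬ b.Holds s
  | and b b' => b.Holds s ∧ b'.Holds s

def size : BExp → ℕ
  | ilt e e' => e.size + e'.size + 1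
  | rlt e e' => e.size + e'.size + 1
  | not b => b.size + 1
  | and b b' => b.size + b'.size + 1

end BExp

/-- `Exec ok c s T s'`: started in `s`, the program `c` halts in state `s'` after exactly `T` steps,
and every real number that it writes into memory on the way satisfies `ok`.  Each operation in an
evaluated expression, each assignment and each branching costs one step. -/
inductive Exec (ok : ℝ → Prop) : Cmd → State → ℕ → State → Prop
  | skip (s : State) : Exec ok Cmd.skip s 1 s
  | iset (s : State) (x : ℕ) (e : IExp) :
      Exec ok (Cmd.iset x e) s (e.size + 1) (s.setIdx x (e.eval s))
  | rset (s : State) (a : ℕ) (i j : IExp) (e : RExp) (h : ok (e.eval s)) :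
      Exec ok (Cmd.rset a i j e) s (i.size + j.size + e.size + 1)
        (s.setMem a (i.eval s) (j.eval s) (e.eval s))
  | seq {c c' : Cmd} {s s' s'' : State} {T T' : ℕ} (h : Exec ok c s T s')
      (h' : Exec ok c' s' T' s'') : Exec ok (Cmd.seq c c') s (T + T') s''
  | ite_true {b : BExp} {c c' : Cmd} {s s' : State} {T : ℕ} (hb : b.Holds s)
      (h : Exec ok c s T s') : Exec ok (Cmd.ite b c c') s (b.size + 1 + T) s'
  | ite_false {b : BExp} {c c' : Cmd} {s s' : State} {T : ℕ} (hb : ¬ b.Holds s)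
      (h : Exec ok c' s T s') : Exec ok (Cmd.ite b c c') s (b.size + 1 + T) s'
  | loop_stop {b : BExp} {c : Cmd} {s : State} (hb : ¬ b.Holds s) :
      Exec ok (Cmd.loop b c) s (b.size + 1) s
  | loop_step {b : BExp} {c : Cmd} {s s' s'' : State} {T T' : ℕ} (hb : b.Holds s)
      (h : Exec ok c s T s') (h' : Exec ok (Cmd.loop b c) s' T' s'') :
      Exec ok (Cmd.loop b c) s (b.size + 1 + T + T') s''

/-! ### Input, output and bit lengths -/

/-- The initial state: index variables `0` and `1` hold `n` and `m`, array `0` holds the costs, array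
`1` the rewards, array `2` the probabilities; everything else is `0`. -/
def Instance.load {n m : ℕ} [NeZero m] (I : Instance n m) : State where
  idx := fun x => if x = 0 then n else if x = 1 then m else 0
  mem := fun a i j =>
    if a = 0 then (if h : i < n ∧ j = 0 then I.cost ⟨i, h.1⟩ else 0)
    else if a = 1 then (if h : i < m ∧ j = 0 then I.reward ⟨i, h.1⟩ else 0)
    else if a = 2 then (if h : i < n ∧ j < m then I.prob ⟨i, h.1⟩ ⟨j, h.2⟩ else 0)
    else 0

/-- The output of a halted run: cell `(0, 0)` of array `3`. -/
def State.output (s : State) : ℝ := s.mem 3 0 0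

/-- `x` is a rational number whose numerator and denominator have at most `L` binary digits. -/
def BitsLE (L : ℕ) (x : ℝ) : Prop :=
  ∃ (a : ℤ) (d : ℕ), 0 < d ∧ x = (a : ℝ) / (d : ℝ) ∧ |a| < 2 ^ L ∧ d < 2 ^ L

/-- All numbers of the instance are rational with at most `L`-bit numerators and denominators. -/
def Instance.BitsLE {n m : ℕ} [NeZero m] (I : Instance n m) (L : ℕ) : Prop :=
  (∀ i, SeqContract.BitsLE L (I.cost i)) ∧ (∀ j, SeqContract.BitsLE L (I.reward j)) ∧
    ∀ i j, SeqContract.BitsLE L (I.prob i j)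

end SeqContract

namespace SeqContract

/-! ### Arithmetic of bit lengths -/

/-! The agent faces Weitzman's search problem with recall. If `σ i` is the index of action `i`, his
optimal utility is the expectation of the maximum of `0` and all `min (t (X i)) (σ i)`
(`value_le_cappedMax`, `exists_value_eq_cappedMax`). Under a linear contract the nonnegative part of
each index is a maximum of at most `m` affine functions of `α`, together with `0` (`isIndex_index`).
For each realization of the outcomes the capped maximum is therefore built by `max` and `min` from
one common family of polynomially many lines. Between two consecutive crossings of these lines,
clamped to `[0, 1]`, it is a single line. Hence the agent's optimal utility `U` is affine there,
although there are exponentially many realizations (`exists_optUtility_eq`).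

Every strategy has utility `α * R - C`, with `R` its expected reward and `C` its expected cost. By
the tie-breaking rule the best response has expected reward equal to the right derivative of `U`, so
the principal gets `(1 - α)` times that slope (`principalUtility_of_affine`). The slope is
nonnegative and constant from one breakpoint to the next, so moving left to a breakpoint never
hurts, and it suffices to compare the breakpoints (`exists_breakpoint_ge`). The slope is a
difference quotient of `U`, and `U` has a polynomial-size formula: the events "action `i` is the
first to attain the maximum" are products over independent actions (`expect_fold_max`).

The optimal parameter thus becomes one fixed arithmetic expression with sums, products and maxima
over actions and outcomes (`eval_optParam`). Such expressions compile to programs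
(`computes_compile`). Since the nesting of the expression is fixed, running time (`time_le`) and bit
lengths (`small_eval`) are polynomial. -/

theorem BitsLE.mono {L L' : ℕ} {x : ℝ} (hx : BitsLE L x) (h : L ≤ L') : BitsLE L' x := by
  obtain ⟨a, d, hd, hx, ha, hd'⟩ := hx
  exact ⟨a, d, hd, hx, ha.trans_le (pow_le_pow_right₀ (by norm_num) h),
    hd'.trans_le (pow_le_pow_right₀ (by norm_num) h)⟩

theorem bitsLE_zero {L : ℕ} (h : 1 ≤ L) : BitsLE L 0 :=
  BitsLE.mono (L := 1) ⟨0, 1, by norm_num, by norm_num, by norm_num, by norm_num⟩ h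

theorem bitsLE_one {L : ℕ} (h : 1 ≤ L) : BitsLE L 1 :=
  BitsLE.mono (L := 1) ⟨1, 1, by norm_num, by norm_num, by norm_num, by norm_num⟩ h

theorem BitsLE.mul {L L' : ℕ} {x y : ℝ} (hx : BitsLE L x) (hy : BitsLE L' y) :
    BitsLE (L + L') (x * y) := by
  obtain ⟨a, d, hd, rfl, ha, hd'⟩ := hx
  obtain ⟨b, e, he, rfl, hb, he'⟩ := hy
  refine ⟨a * b, d * e, by positivity, by push_cast; field_simp, ?_, ?_⟩
  · rw [abs_mul, pow_add]
    exact mul_lt_mul'' ha hb (abs_nonneg _) (abs_nonneg _)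
  · rw [pow_add]
    exact mul_lt_mul'' hd' he' (Nat.zero_le _) (Nat.zero_le _)

theorem BitsLE.neg {L : ℕ} {x : ℝ} (hx : BitsLE L x) : BitsLE L (-x) := by
  obtain ⟨a, d, hd, rfl, ha, hd'⟩ := hx
  exact ⟨-a, d, hd, by push_cast; ring, by rwa [abs_neg], hd'⟩

theorem BitsLE.inv {L : ℕ} {x : ℝ} (hx : BitsLE L x) : BitsLE L x⁻¹ := by
  obtain ⟨a, d, hd, rfl, ha, hd'⟩ := hx
  have key : ∀ a : ℤ, 0 < a → |a| < 2 ^ L → BitsLE L ((a : ℝ) / (d : ℝ))⁻¹ := by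
    intro a h0 ha
    lift a to ℕ using h0.le
    refine ⟨d, a, by exact_mod_cast h0, by simp, ?_, ?_⟩
    · rw [Nat.abs_cast]; exact_mod_cast hd'
    · rw [Nat.abs_cast] at ha; exact_mod_cast ha
  rcases lt_trichotomy a 0 with h | h | h
  · have h1 := (key (-a) (by omega) (by rwa [abs_neg])).neg
    convert h1 using 1
    push_cast
    rw [neg_div, inv_neg, neg_neg]
  · subst h
    -- The inverse of `0` is `0`, whose denominator `1` needs one bit; a positive `d < 2 ^ L`
    -- supplies it.
    have hL : 1 ≤ L := by
      by_contra h
      have : L = 0 := by omega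
      subst this
      simp at hd'
      omega
    simpa using bitsLE_zero hL
  · exact key a h ha

theorem BitsLE.div {L L' : ℕ} {x y : ℝ} (hx : BitsLE L x) (hy : BitsLE L' y) :
    BitsLE (L + L') (x / y) := by
  rw [div_eq_mul_inv]
  exact hx.mul hy.inv

theorem BitsLE.add {L L' : ℕ} {x y : ℝ} (hx : BitsLE L x) (hy : BitsLE L' y) :
    BitsLE (L + L' + 1) (x + y) := by
  obtain ⟨a, d, hd, rfl, ha, hd'⟩ := hx
  obtain ⟨b, e, he, rfl, hb, he'⟩ := hy
  refine ⟨a * e + b * d, d * e, by positivity, by push_cast; field_simp, ?_, ?_⟩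
  · have h1 : |a * e| < 2 ^ L * 2 ^ L' := by
      rw [abs_mul, Nat.abs_cast]
      exact mul_lt_mul'' ha (by exact_mod_cast he') (abs_nonneg _) (by positivity)
    have h2 : |b * d| < 2 ^ L' * 2 ^ L := by
      rw [abs_mul, Nat.abs_cast]
      exact mul_lt_mul'' hb (by exact_mod_cast hd') (abs_nonneg _) (by positivity)
    have h3 := abs_add_le (a * (e : ℤ)) (b * (d : ℤ))
    have h4 : (2 : ℤ) ^ (L + L' + 1) = 2 ^ L * 2 ^ L' + 2 ^ L' * 2 ^ L := by ring
    omega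
  · have h1 : d * e < 2 ^ L * 2 ^ L' := mul_lt_mul'' hd' he' (Nat.zero_le _) (Nat.zero_le _)
    have h2 : 2 ^ (L + L' + 1) = 2 * (2 ^ L * 2 ^ L') := by ring
    omega

theorem BitsLE.sub {L L' : ℕ} {x y : ℝ} (hx : BitsLE L x) (hy : BitsLE L' y) :
    BitsLE (L + L' + 1) (x - y) := by
  rw [sub_eq_add_neg]
  exact hx.add hy.neg

theorem Exec.mono {ok ok' : ℝ → Prop} (h : ∀ x, ok x → ok' x) {c : Cmd} {s s' : State} {T : ℕ}
    (hc : Exec ok c s T s') : Exec ok' c s T s' := by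
  induction hc with
  | rset s a i j e he => exact .rset s a i j e (h _ he)
  | ite_false hb _ h1 => exact .ite_false hb h1
  | _ => constructor <;> assumption

/-! ### Expressions with big operators -/

inductive BigOp : Type
  | sum : BigOp
  | prod : BigOp
  | max : BigOp

namespace BigOp

noncomputable def init : BigOp → ℝ
  | sum => 0
  | prod => 1
  | max => 0

noncomputable def app : BigOp → ℝ → ℝ → ℝ
  | sum, x, y => x + y
  | prod, x, y => x * y
  | max, x, y => Max.max x y

noncomputable def fold (o : BigOp) (f : ℕ → ℝ) : ℕ → ℝ
  | 0 => o.init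
  | N + 1 => o.app (o.fold f N) (f N)

theorem fold_sum (f : ℕ → ℝ) (N : ℕ) : sum.fold f N = ∑ i ∈ Finset.range N, f i := by
  induction N with
  | zero => rfl
  | succ N ih => rw [Finset.sum_range_succ, ← ih]; rfl

theorem fold_prod (f : ℕ → ℝ) (N : ℕ) : prod.fold f N = ∏ i ∈ Finset.range N, f i := by
  induction N with
  | zero => rfl
  | succ N ih => rw [Finset.prod_range_succ, ← ih]; rfl

theorem fold_max_nonneg (f : ℕ → ℝ) (N : ℕ) : 0 ≤ max.fold f N := by
  induction N with
  | zero => exact le_rfl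
  | succ N ih => exact ih.trans (le_max_left _ _)

theorem le_fold_max (f : ℕ → ℝ) {i N : ℕ} (h : i < N) : f i ≤ max.fold f N := by
  induction N with
  | zero => omega
  | succ N ih =>
    rcases Nat.lt_succ_iff_lt_or_eq.1 h with h | rfl
    · exact (ih h).trans (le_max_left _ _)
    · exact le_max_right _ _

theorem fold_max_mem (f : ℕ → ℝ) (N : ℕ) :
    max.fold f N = 0 ∨ ∃ i < N, max.fold f N = f i := by
  induction N with
  | zero => exact Or.inl rfl
  | succ N ih =>
    have h : max.fold f (N + 1) = Max.max (max.fold f N) (f N) := rfl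
    rcases max_choice (max.fold f N) (f N) with h' | h'
    · rw [h, h']
      exact ih.imp_right fun ⟨i, hi, h⟩ => ⟨i, by omega, h⟩
    · exact Or.inr ⟨N, by omega, h.trans h'⟩

theorem init_bits (o : BigOp) {L : ℕ} (h : 1 ≤ L) : SeqContract.BitsLE L o.init := by
  cases o
  · exact bitsLE_zero h
  · exact bitsLE_one h
  · exact bitsLE_zero h

/-- Each step combines the accumulator with a fresh `B`-bit number, so the length grows by at most
`B + 1` instead of doubling. A maximum merely selects an operand. -/
theorem fold_bits (o : BigOp) {f : ℕ → ℝ} {B : ℕ} (hB : 1 ≤ B) {N : ℕ}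
    (hf : ∀ i < N, SeqContract.BitsLE B (f i)) : SeqContract.BitsLE (N * (B + 1) + B) (o.fold f N) := by
  induction N with
  | zero => exact o.init_bits (by omega)
  | succ N ih =>
    have h1 := ih fun i hi => hf i (by omega)
    have h2 := hf N (by omega)
    have e : (N + 1) * (B + 1) + B = N * (B + 1) + B + B + 1 := by ring
    cases o
    · exact (h1.add h2).mono e.ge
    · exact (h1.mul h2).mono (by omega)
    · change SeqContract.BitsLE _ (Max.max _ _)
      rcases max_choice (max.fold f N) (f N) with h' | h' <;> rw [h']
      · exact h1.mono (by omega)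
      · exact h2.mono (by omega)

end BigOp

/-- Ranges of big operators: the actions, the actions and one more, the outcomes. -/
inductive Bound : Type
  | acts : Bound
  | actsSucc : Bound
  | outs : Bound

namespace Bound

def eval (n m : ℕ) : Bound → ℕ
  | acts => n
  | actsSucc => n + 1
  | outs => m

def iexp : Bound → IExp
  | acts => .var 0
  | actsSucc => .add (.var 0) (.const 1)
  | outs => .var 1

theorem eval_le (n m : ℕ) [NeZero m] (b : Bound) : b.eval n m ≤ n + m := by
  have := NeZero.pos m
  cases b <;> simp only [eval] <;> omega

end Bound

inductive BinOp : Type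
  | add : BinOp
  | sub : BinOp
  | mul : BinOp
  | div : BinOp

namespace BinOp

noncomputable def app : BinOp → ℝ → ℝ → ℝ
  | add, x, y => x + y
  | sub, x, y => x - y
  | mul, x, y => x * y
  | div, x, y => x / y

def rexp : BinOp → RExp → RExp → RExp
  | add, x, y => .add x y
  | sub, x, y => .sub x y
  | mul, x, y => .mul x y
  | div, x, y => .div x y

theorem app_bits (o : BinOp) {L : ℕ} {x y : ℝ} (hx : SeqContract.BitsLE L x)
    (hy : SeqContract.BitsLE L y) : SeqContract.BitsLE (2 * L + 1) (o.app x y) := by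
  cases o
  · exact (hx.add hy).mono (by omega)
  · exact (hx.sub hy).mono (by omega)
  · exact (hx.mul hy).mono (by omega)
  · exact (hx.div hy).mono (by omega)

end BinOp

/-- Arithmetic expressions over the numbers of an instance, with named index variables. -/
inductive Expr : Type
  | zero : Expr
  | one : Expr
  | cost (x : ℕ) : Expr
  | reward (x : ℕ) : Expr
  | prob (x y : ℕ) : Expr
  | bin (o : BinOp) (e e' : Expr) : Expr
  /-- `e₃` if `e₁ < e₂`, and `e₄` otherwise -/
  | ifLt (e₁ e₂ e₃ e₄ : Expr) : Expr
  /-- `e` if the index `x` is less than the index `y`, and `e'` otherwise -/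
  | ifIdxLt (x y : ℕ) (e e' : Expr) : Expr
  | big (o : BigOp) (b : Bound) (x : ℕ) (e : Expr) : Expr

namespace Expr

open Function (update)

/-- Inputs are read through `I.load`, so out-of-range indices give `0`, exactly as on the machine.
-/
noncomputable def eval {n m : ℕ} [NeZero m] (I : Instance n m) : Expr → (ℕ → ℕ) → ℝ
  | zero, _ => 0
  | one, _ => 1
  | cost x, ρ => I.load.mem 0 (ρ x) 0
  | reward x, ρ => I.load.mem 1 (ρ x) 0
  | prob x y, ρ => I.load.mem 2 (ρ x) (ρ y)
  | bin o e e', ρ => o.app (e.eval I ρ) (e'.eval I ρ)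
  | ifLt e₁ e₂ e₃ e₄, ρ => if e₁.eval I ρ < e₂.eval I ρ then e₃.eval I ρ else e₄.eval I ρ
  | ifIdxLt x y e e', ρ => if ρ x < ρ y then e.eval I ρ else e'.eval I ρ
  | big o b x e, ρ => o.fold (fun i => e.eval I (update ρ x i)) (b.eval n m)

/-- The `b`-th register is the cell `(b, 0)` of array `3`. -/
def reg (b : ℕ) : RExp := .get 3 (.const b) (.const 0)

def setReg (b : ℕ) (e : RExp) : Cmd := .rset 3 (.const b) (.const 0) e

def bigInit : BigOp → RExp
  | .sum => .zero
  | .prod => .one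
  | .max => .zero

def bigStep (b : ℕ) : BigOp → Cmd
  | .sum => setReg b (.add (reg b) (reg (b + 1)))
  | .prod => setReg b (.mul (reg b) (reg (b + 1)))
  | .max => .ite (.rlt (reg b) (reg (b + 1))) (setReg b (reg (b + 1))) .skip

/-- The program that evaluates an expression into register `b`.  The variables are renamed by `ren`;
the program overwrites only the index variables from `d` on and the registers from `b` on. -/
def compile : Expr → (ℕ → ℕ) → ℕ → ℕ → Cmd
  | zero, _, _, b => setReg b .zero
  | one, _, _, b => setReg b .one
  | cost x, ren, _, b => setReg b (.get 0 (.var (ren x)) (.const 0))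
  | reward x, ren, _, b => setReg b (.get 1 (.var (ren x)) (.const 0))
  | prob x y, ren, _, b => setReg b (.get 2 (.var (ren x)) (.var (ren y)))
  | bin o e e', ren, d, b =>
      -- Registers form a stack: the first value waits in register `b` while the second is computed
      -- from `b + 1` on.
      .seq (e.compile ren d b) (.seq (e'.compile ren d (b + 1))
        (setReg b (o.rexp (reg b) (reg (b + 1)))))
  | ifLt e₁ e₂ e₃ e₄, ren, d, b =>
      .seq (e₁.compile ren d b) (.seq (e₂.compile ren d (b + 1))
        (.ite (.rlt (reg b) (reg (b + 1))) (e₃.compile ren d b) (e₄.compile ren d b)))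
  | ifIdxLt x y e e', ren, d, b =>
      .ite (.ilt (.var (ren x)) (.var (ren y))) (e.compile ren d b) (e'.compile ren d b)
  | big o bd x e, ren, d, b =>
      .seq (setReg b (bigInit o)) (.seq (.iset d (.const 0))
        (.loop (.ilt (.var d) bd.iexp)
          -- Index variable `d` is the counter that represents `x`, and register `b` accumulates;
          -- the body must leave both alone.
          (.seq (e.compile (update ren x d) (d + 1) (b + 1))
            (.seq (bigStep b o) (.iset d (.add (.var d) (.const 1)))))))

/-- A bound for the exponent of the bit length of all numbers written in an evaluation. -/
def deg : Expr → ℕ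
  | zero => 1
  | one => 1
  | cost _ => 1
  | reward _ => 1
  | prob _ _ => 1
  | bin _ e e' => max e.deg e'.deg + 1
  | ifLt e₁ e₂ e₃ e₄ => max (max e₁.deg e₂.deg) (max e₃.deg e₄.deg)
  | ifIdxLt _ _ e e' => max e.deg e'.deg
  | big _ _ _ e => e.deg + 2

/-- A bound for the number of steps of an evaluation, in terms of `n + m`. -/
def time (N : ℕ) : Expr → ℕ
  | zero => 10
  | one => 10
  | cost _ => 10
  | reward _ => 10
  | prob _ _ => 10
  | bin _ e e' => e.time N + e'.time N + 10
  | ifLt e₁ e₂ e₃ e₄ => e₁.time N + e₂.time N + e₃.time N + e₄.time N + 10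
  | ifIdxLt _ _ e e' => e.time N + e'.time N + 10
  | big _ _ _ e => N * (e.time N + 40) + 30

/-- Only big operators multiply the time by `N`, and their nesting is fixed by the expression. -/
theorem time_le (e : Expr) : ∃ C k : ℕ, ∀ N, 1 ≤ N → e.time N ≤ C * N ^ k := by
  have add2 : ∀ {f g : ℕ → ℕ}, (∃ C k : ℕ, ∀ N, 1 ≤ N → f N ≤ C * N ^ k) →
      (∃ C k : ℕ, ∀ N, 1 ≤ N → g N ≤ C * N ^ k) →
      ∃ C k : ℕ, ∀ N, 1 ≤ N → f N + g N ≤ C * N ^ k := by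
    rintro f g ⟨C, k, h⟩ ⟨C', k', h'⟩
    refine ⟨C + C', k + k', fun N hN => ?_⟩
    have h1 : N ^ k ≤ N ^ (k + k') := Nat.pow_le_pow_right hN (by omega)
    have h2 : N ^ k' ≤ N ^ (k + k') := Nat.pow_le_pow_right hN (by omega)
    calc f N + g N ≤ C * N ^ k + C' * N ^ k' := add_le_add (h N hN) (h' N hN)
      _ ≤ C * N ^ (k + k') + C' * N ^ (k + k') := by gcongr
      _ = _ := by ring
  have const : ∀ c : ℕ, ∃ C k : ℕ, ∀ N, 1 ≤ N → c ≤ C * N ^ k :=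
    fun c => ⟨c, 0, fun N _ => by simp⟩
  induction e with
  | zero | one | cost | reward | prob => exact const 10
  | bin o e e' h h' => exact add2 (add2 h h') (const 10)
  | ifLt e₁ e₂ e₃ e₄ h₁ h₂ h₃ h₄ => exact add2 (add2 (add2 (add2 h₁ h₂) h₃) h₄) (const 10)
  | ifIdxLt x y e e' h h' => exact add2 (add2 h h') (const 10)
  | big o b x e h =>
    refine add2 ?_ (const 30)
    obtain ⟨C, k, h⟩ := add2 h (const 40)
    refine ⟨C, k + 1, fun N hN => ?_⟩
    calc N * (e.time N + 40) ≤ N * (C * N ^ k) := Nat.mul_le_mul_left _ (h N hN)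
      _ = _ := by ring

/-! ### Bit lengths of the values of expressions -/

variable {n m : ℕ} [NeZero m] {I : Instance n m}

/-- The bound `(n + m + L + 4) ^ K` for the bit lengths. -/
def Small (I : Instance n m) (K : ℕ) (x : ℝ) : Prop :=
  ∀ L : ℕ, I.BitsLE L → SeqContract.BitsLE ((n + m + L + 4) ^ K) x

theorem Small.mono {K K' : ℕ} {x : ℝ} (hx : Small I K x) (h : K ≤ K') : Small I K' x :=
  fun L hL => (hx L hL).mono (Nat.pow_le_pow_right (by omega) h)

/-- The extra bit leaves room for `0` and `1` without having to know that `L` is positive. -/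
theorem small_of_input {K : ℕ} (hK : 1 ≤ K) {x : ℝ} (h : ∀ L, I.BitsLE L → SeqContract.BitsLE (L + 1) x) :
    Small I K x :=
  Small.mono (K := 1) (fun L hL => (h L hL).mono (by simp; omega)) hK

theorem small_load {K : ℕ} (hK : 1 ≤ K) (a i j : ℕ) : Small I K (I.load.mem a i j) := by
  refine small_of_input hK fun L hL => ?_
  have h0 : SeqContract.BitsLE (L + 1) 0 := bitsLE_zero (by omega)
  simp only [Instance.load]
  split_ifs
  · exact (hL.1 _).mono (by omega)
  · exact h0
  · exact (hL.2.1 _).mono (by omega)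
  · exact h0
  · exact (hL.2.2 _ _).mono (by omega)
  · exact h0
  · exact h0

/-- A binary operation at most doubles the length and adds one bit; the base is at least `4`, so one
more power absorbs this. -/
theorem Small.bin {K : ℕ} {x y : ℝ} (hx : Small I K x) (hy : Small I K y) (o : BinOp) :
    Small I (K + 1) (o.app x y) := by
  intro L hL
  refine (o.app_bits (hx L hL) (hy L hL)).mono ?_
  have h1 : 1 ≤ (n + m + L + 4) ^ K := Nat.one_le_pow _ _ (by omega)
  calc 2 * (n + m + L + 4) ^ K + 1 ≤ (n + m + L + 4) ^ K * 4 := by omega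
    _ ≤ (n + m + L + 4) ^ K * (n + m + L + 4) := Nat.mul_le_mul_left _ (by omega)
    _ = _ := (pow_succ _ _).symm

/-- One additional power pays for the number of terms, the other for the constant factor `3`. -/
theorem Small.fold {K N : ℕ} {f : ℕ → ℝ} (o : BigOp) (hN : N ≤ n + m) (hf : ∀ i < N, Small I K (f i)) :
    Small I (K + 2) (o.fold f N) := by
  intro L hL
  have h1 : 1 ≤ (n + m + L + 4) ^ K := Nat.one_le_pow _ _ (by omega)
  refine (o.fold_bits h1 fun i hi => hf i hi L hL).mono ?_
  set w := n + m + L + 4 with hw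
  calc N * (w ^ K + 1) + w ^ K ≤ w * (w ^ K + w ^ K) + w * w ^ K := by
        gcongr
        · omega
        · exact Nat.le_mul_of_pos_left _ (by omega)
    _ = 3 * (w * w ^ K) := by ring
    _ ≤ w * (w * w ^ K) := Nat.mul_le_mul_right _ (by omega)
    _ = w ^ (K + 2) := by ring

theorem small_eval (e : Expr) (ρ : ℕ → ℕ) : Small I e.deg (e.eval I ρ) := by
  induction e generalizing ρ with
  | zero => exact small_of_input le_rfl fun L _ => bitsLE_zero (by omega)
  | one => exact small_of_input le_rfl fun L _ => bitsLE_one (by omega)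
  | cost | reward | prob => exact small_load le_rfl _ _ _
  | bin o e e' h h' =>
    exact ((h ρ).mono (le_max_left _ _)).bin ((h' ρ).mono (le_max_right _ _)) o
  | ifLt e₁ e₂ e₃ e₄ h₁ h₂ h₃ h₄ =>
    simp only [eval]
    split_ifs
    · exact (h₃ ρ).mono (by simp only [deg]; omega)
    · exact (h₄ ρ).mono (by simp only [deg]; omega)
  | ifIdxLt x y e e' h h' =>
    simp only [eval]
    split_ifs
    · exact (h ρ).mono (by simp only [deg]; omega)
    · exact (h' ρ).mono (by simp only [deg]; omega)
  | big o b x e h => exact Small.fold o (b.eval_le n m) fun i _ => h _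

/-! ### Correctness and cost of compiled programs -/

/-- The state `s` still holds the input. -/
structure HasInput (I : Instance n m) (s : State) : Prop where
  idx_zero : s.idx 0 = n
  idx_one : s.idx 1 = m
  mem : ∀ a < 3, s.mem a = I.load.mem a

/-- From `s` to `s'` at most the index variables from `d` on and the registers from `b` on are
changed. -/
structure Frame (d b : ℕ) (s s' : State) : Prop where
  idx : ∀ x < d, s'.idx x = s.idx x
  mem : ∀ a, a ≠ 3 → s'.mem a = s.mem a
  reg : ∀ i < b, ∀ j, s'.mem 3 i j = s.mem 3 i j

theorem Frame.trans {d b : ℕ} {s s' s'' : State} (h : Frame d b s s') (h' : Frame d b s' s'') :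
    Frame d b s s'' where
  idx x hx := (h'.idx x hx).trans (h.idx x hx)
  mem a ha := (h'.mem a ha).trans (h.mem a ha)
  reg i hi j := (h'.reg i hi j).trans (h.reg i hi j)

theorem Frame.mono {d b d' b' : ℕ} {s s' : State} (h : Frame d' b' s s') (hd : d ≤ d')
    (hb : b ≤ b') : Frame d b s s' where
  idx x hx := h.idx x (by omega)
  mem a ha := h.mem a ha
  reg i hi j := h.reg i (by omega) j

theorem HasInput.frame {d b : ℕ} {s s' : State} (hs : HasInput I s) (h : Frame d b s s')
    (hd : 2 ≤ d) : HasInput I s' where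
  idx_zero := (h.idx 0 (by omega)).trans hs.idx_zero
  idx_one := (h.idx 1 (by omega)).trans hs.idx_one
  mem a ha := (h.mem a (by omega)).trans (hs.mem a ha)

theorem frame_setMem (d b : ℕ) (s : State) (v : ℝ) : Frame d b s (s.setMem 3 b 0 v) where
  idx _ _ := rfl
  mem a ha := by funext i j; simp [State.setMem, ha]
  reg i hi j := by simp [State.setMem, hi.ne]

theorem frame_setIdx (d b : ℕ) (s : State) (v : ℕ) : Frame d b s (s.setIdx d v) where
  idx x hx := by simp [State.setIdx, hx.ne]
  mem _ _ := rfl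
  reg _ _ _ := rfl

theorem HasInput.bound_eval {s : State} (hs : HasInput I s) (b : Bound) :
    b.iexp.eval s = b.eval n m := by
  cases b <;> simp [Bound.iexp, Bound.eval, IExp.eval, hs.idx_zero, hs.idx_one]

theorem exec_setReg {ok : ℝ → Prop} (b : ℕ) (e : RExp) (s : State) (h : ok (e.eval s)) :
    Exec ok (setReg b e) s (e.size + 3) (s.setMem 3 b 0 (e.eval s)) := by
  have := Exec.rset s 3 (.const b) (.const 0) e h
  rwa [show (IExp.const b).size + (IExp.const 0).size + e.size + 1 = e.size + 3 by
    simp only [IExp.size]; omega] at this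

/-- The program `c` computes the value `v` into register `b`. -/
def Computes (I : Instance n m) (K : ℕ) (c : Cmd) (d b : ℕ) (s : State) (T : ℕ) (v : ℝ) : Prop :=
  ∃ T' s', Exec (Small I K) c s T' s' ∧ T' ≤ T ∧ Frame d b s s' ∧ s'.mem 3 b 0 = v

theorem computes_setReg {K d b : ℕ} {s : State} {T : ℕ} (e : RExp) (h : Small I K (e.eval s))
    (hT : e.size + 3 ≤ T) : Computes I K (setReg b e) d b s T (e.eval s) :=
  ⟨_, _, exec_setReg b e s h, hT, frame_setMem d b s _, by simp [State.setMem]⟩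

theorem exec_bigStep {K d b : ℕ} {s : State} (o : BigOp)
    (h : Small I K (o.app (s.mem 3 b 0) (s.mem 3 (b + 1) 0))) :
    Computes I K (bigStep b o) d b s 20 (o.app (s.mem 3 b 0) (s.mem 3 (b + 1) 0)) := by
  cases o
  · exact computes_setReg (.add (reg b) (reg (b + 1))) h (by simp [RExp.size, IExp.size, reg])
  · exact computes_setReg (.mul (reg b) (reg (b + 1))) h (by simp [RExp.size, IExp.size, reg])
  · simp only [BigOp.app] at h ⊢
    by_cases hb : (BExp.rlt (reg b) (reg (b + 1))).Holds s
    · have hb' : s.mem 3 b 0 < s.mem 3 (b + 1) 0 := hb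
      rw [max_eq_right hb'.le] at h ⊢
      obtain ⟨T, s', h1, h2, h3⟩ := computes_setReg (d := d) (b := b) (T := 6) (reg (b + 1)) h
        (by simp [RExp.size, IExp.size, reg])
      refine ⟨_, s', .ite_true hb h1, ?_, h3⟩
      simp only [BExp.size, RExp.size, IExp.size, reg]
      omega
    · have hb' : s.mem 3 (b + 1) 0 ≤ s.mem 3 b 0 := not_lt.1 hb
      rw [max_eq_left hb']
      refine ⟨_, s, .ite_false hb (.skip s), ?_, ⟨fun _ _ => rfl, fun _ _ => rfl, fun _ _ _ => rfl⟩,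
        rfl⟩
      simp only [BExp.size, RExp.size, IExp.size, reg]
      omega

theorem eval_bigInit (o : BigOp) (s : State) : (bigInit o).eval s = o.init := by
  cases o <;> rfl

theorem size_bigInit (o : BigOp) : (bigInit o).size = 1 := by
  cases o <;> rfl

theorem eval_binOp (o : BinOp) (e e' : RExp) (s : State) :
    (o.rexp e e').eval s = o.app (e.eval s) (e'.eval s) := by
  cases o <;> rfl

theorem size_binOp (o : BinOp) (e e' : RExp) : (o.rexp e e').size = e.size + e'.size + 1 := by
  cases o <;> rfl

theorem size_bound (b : Bound) : b.iexp.size ≤ 3 := by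
  cases b <;> decide

/-- Loop invariant: the counter is `l` and register `b` holds the fold of the first `l` terms. The
induction is on the number `r` of remaining rounds. Comparing variables below `d` with the fixed
state `s₀` ensures that every round evaluates the same `f`. -/
theorem computes_loop {K d b N Te : ℕ} {body : Cmd} {bd : Bound} (o : BigOp) (f : ℕ → ℝ)
    (hd : 2 ≤ d) (hN : bd.eval n m = N) (hK : ∀ l ≤ N, Small I K (o.fold f l)) {s₀ : State}
    (hbody : ∀ s l, l < N → HasInput I s → s.idx d = l → (∀ x < d, s.idx x = s₀.idx x) →
      Computes I K body (d + 1) (b + 1) s Te (f l)) (r : ℕ) :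
    ∀ s l, l + r = N → HasInput I s → s.idx d = l → (∀ x < d, s.idx x = s₀.idx x) →
      s.mem 3 b 0 = o.fold f l →
      Computes I K (.loop (.ilt (.var d) bd.iexp)
        (.seq body (.seq (bigStep b o) (.iset d (.add (.var d) (.const 1)))))) d b s
        (r * (Te + 40) + 10) (o.fold f N) := by
  have hsz : (BExp.ilt (.var d) bd.iexp).size ≤ 5 := by
    have := size_bound bd
    simp only [BExp.size, IExp.size]
    omega
  induction r with
  | zero =>
    intro s l hl hs hd' hx hm
    have hl : l = N := by omega
    have hb : ¬ (BExp.ilt (.var d) bd.iexp).Holds s := by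
      simp only [BExp.Holds, hs.bound_eval, IExp.eval]
      omega
    exact ⟨_, s, by constructor; exact hb, by omega, ⟨fun _ _ => rfl, fun _ _ => rfl, fun _ _ _ => rfl⟩,
      hl ▸ hm⟩
  | succ r ih =>
    intro s l hl hs hd' hx hm
    have hb : (BExp.ilt (.var d) bd.iexp).Holds s := by
      simp only [BExp.Holds, hs.bound_eval, IExp.eval]
      omega
    obtain ⟨T₁, s₁, h₁, hT₁, hF₁, hv₁⟩ := hbody s l (by omega) hs hd' hx
    have hr₁ : s₁.mem 3 b 0 = o.fold f l := (hF₁.reg b (by omega) 0).trans hm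
    have hnew : o.app (s₁.mem 3 b 0) (s₁.mem 3 (b + 1) 0) = o.fold f (l + 1) := by
      rw [hr₁, hv₁]; rfl
    obtain ⟨T₂, s₂, h₂, hT₂, hF₂, hv₂⟩ := exec_bigStep (d := d + 1) o
      (hnew ▸ hK (l + 1) (by omega) : Small I K (o.app (s₁.mem 3 b 0) (s₁.mem 3 (b + 1) 0)))
    have hi₂ : s₂.idx d = l := by rw [hF₂.idx d (by omega), hF₁.idx d (by omega), hd']
    have h₃ := Exec.iset (ok := Small I K) s₂ d (.add (.var d) (.const 1))
    simp only [IExp.eval, IExp.size, hi₂] at h₃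
    have hF₃ : Frame d b s (s₂.setIdx d (l + 1)) :=
      ((hF₁.mono (by omega) (by omega)).trans (hF₂.mono (by omega) le_rfl)).trans
        (frame_setIdx d b s₂ (l + 1))
    obtain ⟨T₄, s₄, h₄, hT₄, hF₄, hv₄⟩ := ih (s₂.setIdx d (l + 1)) (l + 1) (by omega)
      (hs.frame hF₃ hd) (by simp [State.setIdx]) (fun x hx' => (hF₃.idx x hx').trans (hx x hx'))
      (by rw [← hnew, ← hv₂]; rfl)
    refine ⟨_, s₄, .loop_step hb (.seq h₁ (.seq h₂ h₃)) h₄, ?_, hF₃.trans hF₄, hv₄⟩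
    rw [add_mul, one_mul]
    omega

/-- Free variables live below `d` and so survive every subcomputation; `2 ≤ d` protects the index
variables holding `n` and `m`. -/
theorem computes_compile (e : Expr) {K : ℕ} (hK : e.deg ≤ K) (ren : ℕ → ℕ) (d b : ℕ) (s : State)
    (hd : 2 ≤ d) (hren : ∀ x, ren x < d) (hs : HasInput I s) :
    Computes I K (e.compile ren d b) d b s (e.time (n + m)) (e.eval I fun x => s.idx (ren x)) := by
  induction e generalizing ren d b s with
  | zero =>
    exact computes_setReg (.zero) ((small_eval zero fun _ => 0).mono hK) (by simp [RExp.size, time])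
  | one =>
    exact computes_setReg (.one) ((small_eval one fun _ => 0).mono hK) (by simp [RExp.size, time])
  | cost x =>
    have h := hs.mem 0 (by norm_num)
    have := computes_setReg (I := I) (K := K) (d := d) (b := b) (s := s) (T := 10)
      (.get 0 (.var (ren x)) (.const 0))
      (by simp only [RExp.eval, h]; exact small_load hK _ _ _) (by simp [RExp.size, IExp.size])
    simp only [RExp.eval, h] at this
    exact this
  | reward x =>
    have h := hs.mem 1 (by norm_num)
    have := computes_setReg (I := I) (K := K) (d := d) (b := b) (s := s) (T := 10)
      (.get 1 (.var (ren x)) (.const 0))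
      (by simp only [RExp.eval, h]; exact small_load hK _ _ _) (by simp [RExp.size, IExp.size])
    simp only [RExp.eval, h] at this
    exact this
  | prob x y =>
    have h := hs.mem 2 (by norm_num)
    have := computes_setReg (I := I) (K := K) (d := d) (b := b) (s := s) (T := 10)
      (.get 2 (.var (ren x)) (.var (ren y)))
      (by simp only [RExp.eval, h]; exact small_load hK _ _ _) (by simp [RExp.size, IExp.size])
    simp only [RExp.eval, h] at this
    exact this
  | bin o e e' ih ih' =>
    have hK' : max e.deg e'.deg + 1 ≤ K := hK
    obtain ⟨T₁, s₁, h₁, hT₁, hF₁, hv₁⟩ := ih (by omega) ren d b s hd hren hs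
    obtain ⟨T₂, s₂, h₂, hT₂, hF₂, hv₂⟩ :=
      ih' (by omega) ren d (b + 1) s₁ hd hren (hs.frame hF₁ hd)
    have he : (o.rexp (reg b) (reg (b + 1))).eval s₂
        = (bin o e e').eval I fun x => s.idx (ren x) := by
      rw [eval_binOp]
      simp only [reg, RExp.eval, IExp.eval, eval]
      rw [hF₂.reg b (by omega), hv₁, hv₂]
      simp only [hF₁.idx _ (hren _)]
    obtain ⟨T₃, s₃, h₃, hT₃, hF₃, hv₃⟩ := computes_setReg (I := I) (K := K) (d := d) (b := b)
      (T := 10) (o.rexp (reg b) (reg (b + 1))) (s := s₂)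
      (he ▸ (small_eval _ _).mono hK) (by rw [size_binOp]; simp [RExp.size, IExp.size, reg])
    refine ⟨_, s₃, .seq h₁ (.seq h₂ h₃), ?_, (hF₁.trans (hF₂.mono le_rfl (by omega))).trans hF₃,
      hv₃.trans he⟩
    simp only [time]
    omega
  | ifLt e₁ e₂ e₃ e₄ ih₁ ih₂ ih₃ ih₄ =>
    have hK' : max (max e₁.deg e₂.deg) (max e₃.deg e₄.deg) ≤ K := hK
    obtain ⟨T₁, s₁, h₁, hT₁, hF₁, hv₁⟩ := ih₁ (by omega) ren d b s hd hren hs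
    have hs₁ := hs.frame hF₁ hd
    obtain ⟨T₂, s₂, h₂, hT₂, hF₂, hv₂⟩ := ih₂ (by omega) ren d (b + 1) s₁ hd hren hs₁
    have hs₂ := hs₁.frame hF₂ hd
    have hF := hF₁.trans (hF₂.mono le_rfl (by omega : b ≤ b + 1))
    have hρ : (fun x => s₂.idx (ren x)) = fun x => s.idx (ren x) :=
      funext fun x => hF.idx _ (hren x)
    have hρ₁ : (fun x => s₁.idx (ren x)) = fun x => s.idx (ren x) :=
      funext fun x => hF₁.idx _ (hren x)
    have hb : (BExp.rlt (reg b) (reg (b + 1))).Holds s₂ ↔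
        (e₁.eval I fun x => s.idx (ren x)) < e₂.eval I fun x => s.idx (ren x) := by
      simp only [BExp.Holds, reg, RExp.eval, IExp.eval]
      rw [hF₂.reg b (by omega), hv₁, hv₂, hρ₁]
    have hsz : (BExp.rlt (reg b) (reg (b + 1))).size = 7 := rfl
    by_cases hc : (BExp.rlt (reg b) (reg (b + 1))).Holds s₂
    · obtain ⟨T₃, s₃, h₃, hT₃, hF₃, hv₃⟩ := ih₃ (by omega) ren d b s₂ hd hren hs₂
      refine ⟨_, s₃, .seq h₁ (.seq h₂ (.ite_true hc h₃)), ?_, hF.trans hF₃, ?_⟩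
      · simp only [time]
        omega
      · rw [hv₃, hρ]
        simp only [eval]
        rw [if_pos (hb.1 hc)]
    · obtain ⟨T₃, s₃, h₃, hT₃, hF₃, hv₃⟩ := ih₄ (by omega) ren d b s₂ hd hren hs₂
      refine ⟨_, s₃, .seq h₁ (.seq h₂ (.ite_false hc h₃)), ?_, hF.trans hF₃, ?_⟩
      · simp only [time]
        omega
      · rw [hv₃, hρ]
        simp only [eval]
        rw [if_neg (hb.not.1 hc)]
  | ifIdxLt x y e e' ih ih' =>
    have hK' : max e.deg e'.deg ≤ K := hK
    have hsz : (BExp.ilt (.var (ren x)) (.var (ren y))).size = 3 := rfl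
    by_cases hc : (BExp.ilt (.var (ren x)) (.var (ren y))).Holds s
    · obtain ⟨T₃, s₃, h₃, hT₃, hF₃, hv₃⟩ := ih (by omega) ren d b s hd hren hs
      refine ⟨_, s₃, .ite_true hc h₃, ?_, hF₃, ?_⟩
      · simp only [time]
        omega
      · rw [hv₃]
        exact (if_pos hc).symm
    · obtain ⟨T₃, s₃, h₃, hT₃, hF₃, hv₃⟩ := ih' (by omega) ren d b s hd hren hs
      refine ⟨_, s₃, .ite_false hc h₃, ?_, hF₃, ?_⟩
      · simp only [time]
        omega
      · rw [hv₃]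
        exact (if_neg hc).symm
  | big o bd x e ih =>
    have hK' : e.deg + 2 ≤ K := hK
    set f : ℕ → ℝ := fun i => e.eval I (update (fun y => s.idx (ren y)) x i) with hf
    have hle := bd.eval_le n m
    have hfold : ∀ l ≤ bd.eval n m, Small I K (o.fold f l) := fun l hl =>
      (Small.fold o (by omega) fun i _ => small_eval e _).mono hK'
    have h₁ := exec_setReg (ok := Small I K) b (bigInit o) s
      (by rw [eval_bigInit]; exact hfold 0 (Nat.zero_le _))
    rw [eval_bigInit, size_bigInit] at h₁
    have hF₁ := frame_setMem d b s o.init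
    have h₂ := Exec.iset (ok := Small I K) (s.setMem 3 b 0 o.init) d (.const 0)
    have hF₂ := hF₁.trans (frame_setIdx d b _ 0)
    obtain ⟨T₃, s₃, h₃, hT₃, hF₃, hv₃⟩ := computes_loop (I := I) (K := K) (b := b)
      (Te := e.time (n + m)) (body := e.compile (update ren x d) (d + 1) (b + 1)) (bd := bd) o f hd rfl
      hfold (s₀ := s) (fun s' l hl hs' hl' hx => by
        have h := ih (by omega) (update ren x d) (d + 1) (b + 1) s' (by omega)
          (fun y => by
            rcases eq_or_ne y x with rfl | hy
            · simp
            · rw [Function.update_of_ne hy]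
              have := hren y
              omega) hs'
        have hρ : (fun y => s'.idx (update ren x d y))
            = update (fun y => s.idx (ren y)) x l := by
          funext y
          rcases eq_or_ne y x with rfl | hy
          · simp [hl']
          · rw [Function.update_of_ne hy, Function.update_of_ne hy, hx _ (hren y)]
        rwa [hρ] at h) (bd.eval n m) _ 0 (by omega) (hs.frame hF₂ hd) (by simp [State.setIdx])
        hF₂.idx (by simp [State.setIdx, State.setMem, BigOp.fold])
    refine ⟨_, s₃, .seq h₁ (.seq h₂ h₃), ?_, hF₂.trans hF₃, hv₃⟩
    have : bd.eval n m * (e.time (n + m) + 40) ≤ (n + m) * (e.time (n + m) + 40) :=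
      Nat.mul_le_mul_right _ hle
    simp only [time, IExp.size]
    omega

/-- Closed expressions are evaluated in polynomial time, with numbers of polynomial bit length. -/
theorem exists_program (e : Expr) : ∃ (prog : Cmd) (C k : ℕ), ∀ (n m : ℕ) [NeZero m]
    (I : Instance n m), ∃ (T : ℕ) (s : State),
      Exec (fun x => ∀ L : ℕ, I.BitsLE L → SeqContract.BitsLE (C * (n + m + L) ^ k) x)
        prog I.load T s ∧ T ≤ C * (n + m) ^ k ∧ s.output = e.eval I fun _ => n := by
  obtain ⟨C, k, hCk⟩ := e.time_le
  -- Register `0` is the output cell. All free variables are renamed to index variable `0`, which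
  -- holds `n`; this explains the environment in the conclusion. As `1 ≤ m`, the base `n + m + L +
  -- 4` is at most `5 * (n + m + L)`, whence `5 ^ e.deg`.
  refine ⟨e.compile (fun _ => 0) 2 0, C + 5 ^ e.deg, k + e.deg, fun n m _ I => ?_⟩
  have hm := NeZero.pos m
  obtain ⟨T, s, hex, hT, -, hv⟩ := computes_compile (I := I) e le_rfl (fun _ => 0) 2 0 I.load le_rfl
    (fun _ => by norm_num) ⟨rfl, rfl, fun _ _ => rfl⟩
  refine ⟨T, s, hex.mono fun x hx L hL => (hx L hL).mono ?_, hT.trans ((hCk _ (by omega)).trans ?_),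
    hv⟩
  · exact Nat.mul_le_mul (Nat.le_add_right _ _) (Nat.pow_le_pow_right (by omega) (by omega))
  · calc (n + m + L + 4) ^ e.deg ≤ (5 * (n + m + L)) ^ e.deg :=
          Nat.pow_le_pow_left (by omega) _
      _ = 5 ^ e.deg * (n + m + L) ^ e.deg := mul_pow _ _ _
      _ ≤ (C + 5 ^ e.deg) * (n + m + L) ^ (k + e.deg) :=
          Nat.mul_le_mul (Nat.le_add_left _ _) (Nat.pow_le_pow_right (by omega) (by omega))

end Expr
end SeqContract

namespace SeqContract

open Function (update)

/-! ### The agent's problem: optimal search with recall -/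

namespace Plan

variable {n m : ℕ}

theorem Legal.notMem_actions {π : Plan n m} {S : Finset (Fin n)} {R : Finset (Fin m)}
    (h : π.Legal S R) {i : Fin n} (hi : i ∈ S) (X : Fin n → Fin m) : i ∉ π.actions X := by
  induction π generalizing S R with
  | halt j => simp [actions]
  | take i' next ih =>
    simp only [actions, Finset.mem_insert, not_or]
    exact ⟨fun e => h.1 (e ▸ hi), ih _ (h.2 _) (Finset.mem_insert_of_mem hi)⟩

/-- A legal continuation never takes `i` again, hence never consults `X i`. This makes it
independent of the outcome already revealed. -/
theorem Legal.finalOutcome_update {π : Plan n m} {S : Finset (Fin n)} {R : Finset (Fin m)}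
    (h : π.Legal S R) {i : Fin n} (hi : i ∈ S) (X : Fin n → Fin m) (l : Fin m) :
    π.finalOutcome (update X i l) = π.finalOutcome X := by
  induction π generalizing S R with
  | halt j => rfl
  | take i' next ih =>
    have hne : i' ≠ i := fun e => h.1 (e ▸ hi)
    simp only [finalOutcome, Function.update_of_ne hne]
    exact ih _ (h.2 _) (Finset.mem_insert_of_mem hi)

theorem Legal.actions_update {π : Plan n m} {S : Finset (Fin n)} {R : Finset (Fin m)}
    (h : π.Legal S R) {i : Fin n} (hi : i ∈ S) (X : Fin n → Fin m) (l : Fin m) :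
    π.actions (update X i l) = π.actions X := by
  induction π generalizing S R with
  | halt j => rfl
  | take i' next ih =>
    have hne : i' ≠ i := fun e => h.1 (e ▸ hi)
    simp only [actions, Function.update_of_ne hne]
    rw [ih _ (h.2 _) (Finset.mem_insert_of_mem hi)]

end Plan

theorem fold_max_max {ι : Type*} [DecidableEq ι] (T : Finset ι) (v a : ℝ) (f : ι → ℝ) :
    T.fold max (max v a) f = max a (T.fold max v f) := by
  induction T using Finset.induction_on with
  | empty => simp [max_comm]
  | insert i T hi ih => rw [Finset.fold_insert hi, Finset.fold_insert hi, ih, max_left_comm]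

namespace Instance

variable {n m : ℕ} [NeZero m] (I : Instance n m)

/-! ### Expectation over independent outcomes -/

theorem weight_nonneg (X : Fin n → Fin m) : 0 ≤ ∏ i, I.prob i (X i) :=
  Finset.prod_nonneg fun i _ => I.prob_nonneg i _

theorem expect_prod (φ : Fin n → Fin m → ℝ) :
    I.expect (fun X => ∏ i, φ i (X i)) = ∏ i, ∑ j, I.prob i j * φ i j := by
  rw [Finset.prod_univ_sum, Fintype.piFinset_univ]
  exact Finset.sum_congr rfl fun X _ => Finset.prod_mul_distrib.symm

theorem expect_const (a : ℝ) : I.expect (fun _ => a) = a := by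
  have h := I.expect_prod fun _ _ => 1
  simp only [Finset.prod_const_one, mul_one, I.prob_sum] at h
  unfold expect at h ⊢
  simp only [mul_one] at h
  rw [← Finset.sum_mul, h, one_mul]

theorem expect_add (f g : (Fin n → Fin m) → ℝ) :
    I.expect (fun X => f X + g X) = I.expect f + I.expect g := by
  simp only [expect, mul_add, Finset.sum_add_distrib]

theorem expect_sub (f g : (Fin n → Fin m) → ℝ) :
    I.expect (fun X => f X - g X) = I.expect f - I.expect g := by
  simp only [expect, mul_sub, Finset.sum_sub_distrib]

theorem expect_const_mul (a : ℝ) (f : (Fin n → Fin m) → ℝ) :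
    I.expect (fun X => a * f X) = a * I.expect f := by
  simp only [expect, Finset.mul_sum, mul_left_comm]

theorem expect_sum {ι : Type*} (s : Finset ι) (f : ι → (Fin n → Fin m) → ℝ) :
    I.expect (fun X => ∑ a ∈ s, f a X) = ∑ a ∈ s, I.expect (f a) := by
  simp only [expect, Finset.mul_sum]
  exact Finset.sum_comm

theorem expect_mono {f g : (Fin n → Fin m) → ℝ} (h : ∀ X, f X ≤ g X) : I.expect f ≤ I.expect g :=
  Finset.sum_le_sum fun X _ => mul_le_mul_of_nonneg_left (h X) (I.weight_nonneg X)

/-- Resampling the outcome of action `i` does not change the expectation. -/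
theorem expect_resample (i : Fin n) (f : (Fin n → Fin m) → ℝ) :
    I.expect (fun X => ∑ j, I.prob i j * f (update X i j)) = I.expect f := by
  have hw : ∀ X : Fin n → Fin m, ∏ k, I.prob k (X k)
      = I.prob i (X i) * ∏ k ∈ Finset.univ.erase i, I.prob k (X k) := fun X =>
    (Finset.mul_prod_erase _ _ (Finset.mem_univ i)).symm
  have hw' : ∀ (X : Fin n → Fin m) (j : Fin m),
      ∏ k ∈ Finset.univ.erase i, I.prob k (update X i j k)
        = ∏ k ∈ Finset.univ.erase i, I.prob k (X k) := fun X j =>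
    Finset.prod_congr rfl fun k hk => by rw [Function.update_of_ne (Finset.ne_of_mem_erase hk)]
  -- Swapping the `i`-th outcome with the fresh sample is an involution that preserves the joint
  -- weight.
  let e : (Fin n → Fin m) × Fin m → (Fin n → Fin m) × Fin m := fun q => (update q.1 i q.2, q.1 i)
  have he : Function.Involutive e := fun q => by simp [e]
  have h1 : I.expect (fun X => ∑ j, I.prob i j * f (update X i j))
      = ∑ q : (Fin n → Fin m) × Fin m,
        (∏ k, I.prob k (q.1 k)) * (I.prob i q.2 * f (update q.1 i q.2)) := by
    simp only [expect, Finset.mul_sum, Fintype.sum_prod_type]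
  have h2 : I.expect f = ∑ q : (Fin n → Fin m) × Fin m,
      (∏ k, I.prob k (q.1 k)) * (I.prob i q.2 * f q.1) := by
    simp only [expect, Fintype.sum_prod_type]
    refine Finset.sum_congr rfl fun X _ => ?_
    rw [← Finset.mul_sum, ← Finset.sum_mul, I.prob_sum, one_mul]
  rw [h1, h2]
  refine Fintype.sum_equiv he.toPerm _ _ fun q => ?_
  simp only [Function.Involutive.coe_toPerm, e]
  rw [hw, hw (update _ _ _), hw', Function.update_self]
  ring

/-- Conditioning on `X i`: after resampling coordinate `i`, which `h j` ignores, only the explicit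
argument depends on the sample. -/
theorem expect_split (i : Fin n) (h : Fin m → (Fin n → Fin m) → ℝ)
    (hh : ∀ j X l, h j (update X i l) = h j X) :
    I.expect (fun X => h (X i) X) = ∑ j, I.prob i j * I.expect (h j) := by
  rw [← I.expect_resample i]
  simp only [Function.update_self, hh, I.expect_sum, I.expect_const_mul]

/-! ### Weitzman's index theorem -/

/-- The expected utility of a plan, computed recursively. -/
noncomputable def value (t : Fin m → ℝ) : Plan n m → ℝ
  | .halt j => t j
  | .take i next => (∑ j, I.prob i j * value t (next j)) - I.cost i

/-- Legality is used twice: the cost of the first action is charged exactly once, and the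
continuations do not depend on its coordinate, so the expectation splits. -/
theorem agentUtility_eq_value (t : Fin m → ℝ) {π : Plan n m} {S : Finset (Fin n)}
    {R : Finset (Fin m)} (h : π.Legal S R) : I.agentUtility t π = I.value t π := by
  induction π generalizing S R with
  | halt j => simp [agentUtility, value, Plan.finalOutcome, Plan.actions, I.expect_const]
  | take i next ih =>
    have h1 : ∀ X, t ((Plan.take i next).finalOutcome X) - ∑ k ∈ (Plan.take i next).actions X, I.cost k
        = (t ((next (X i)).finalOutcome X) - ∑ k ∈ (next (X i)).actions X, I.cost k) - I.cost i := by
      intro X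
      simp only [Plan.finalOutcome, Plan.actions]
      rw [Finset.sum_insert ((h.2 _).notMem_actions (Finset.mem_insert_self i S) X)]
      ring
    simp only [agentUtility, h1, value, expect_sub, expect_const]
    rw [← I.expect_sub]
    rw [I.expect_split i (fun j X => t ((next j).finalOutcome X) - ∑ k ∈ (next j).actions X, I.cost k)]
    · congr 1
      exact Finset.sum_congr rfl fun j _ => by rw [← ih j (h.2 j)]; rfl
    · intro j X l
      rw [(h.2 j).finalOutcome_update (Finset.mem_insert_self i S),
        (h.2 j).actions_update (Finset.mem_insert_self i S)]

/-- `σ` is an index of action `i` under the contract `t`: the cost of the action is the expected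
excess of the payment over `σ`, with the correction needed when the true index is negative. -/
structure IsIndex (t : Fin m → ℝ) (i : Fin n) (σ : ℝ) : Prop where
  nonneg : 0 ≤ σ
  excess_le : ∑ j, I.prob i j * max (t j - σ) 0 ≤ I.cost i
  le_excess : 0 < σ → I.cost i ≤ ∑ j, I.prob i j * max (t j - σ) 0

section Search

variable (t : Fin m → ℝ) (σ : Fin n → ℝ)

/-- The expectation of the largest capped payment of the actions in `T`, or `v`. -/
noncomputable def cappedMax (T : Finset (Fin n)) (v : ℝ) : ℝ :=
  I.expect fun X => T.fold max v fun i => min (t (X i)) (σ i)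

variable {t σ}

omit [NeZero m] in
theorem fold_update_eq {T : Finset (Fin n)} {i : Fin n} (hi : i ∉ T) (v : ℝ) (X : Fin n → Fin m)
    (l : Fin m) : (T.fold max v fun k => min (t (update X i l k)) (σ k))
      = T.fold max v fun k => min (t (X k)) (σ k) :=
  Finset.fold_congr fun k hk => by
    have hne : k ≠ i := by
      rintro rfl
      exact hi hk
    rw [Function.update_of_ne hne]

theorem cappedMax_eq {T : Finset (Fin n)} {i : Fin n} (hi : i ∈ T) (v : ℝ) :
    I.cappedMax t σ T v = ∑ j, I.prob i j * I.expect fun X =>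
      max (min (t j) (σ i)) ((T.erase i).fold max v fun k => min (t (X k)) (σ k)) := by
  rw [← I.expect_split i (fun j X =>
    max (min (t j) (σ i)) ((T.erase i).fold max v fun k => min (t (X k)) (σ k)))]
  · unfold cappedMax
    congr 1
    funext X
    conv_lhs => rw [← Finset.insert_erase hi]
    rw [Finset.fold_insert (Finset.notMem_erase i T)]
  · intro j X l
    rw [fold_update_eq (Finset.notMem_erase i T)]

theorem cappedMax_max (T : Finset (Fin n)) (v a : ℝ) : I.cappedMax t σ T (max v a)
    = I.expect fun X => max a (T.fold max v fun k => min (t (X k)) (σ k)) := by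
  simp only [cappedMax, fold_max_max]

theorem max_le_max_min_add (a s x : ℝ) : max a x ≤ max (min a s) x + max (a - s) 0 := by
  rcases le_total a s with h | h
  · rw [min_eq_left h]
    exact le_add_of_nonneg_right (le_max_right _ _)
  · rw [min_eq_right h, max_eq_left (sub_nonneg.2 h)]
    refine max_le ?_ ?_
    · linarith [le_max_left s x]
    · linarith [le_max_right s x]

theorem max_eq_max_min_add {a s x : ℝ} (hx : x ≤ s) :
    max a x = max (min a s) x + max (a - s) 0 := by
  rcases le_total a s with h | h
  · rw [min_eq_left h, max_eq_right (sub_nonpos.2 h), add_zero]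
  · rw [min_eq_right h, max_eq_left (sub_nonneg.2 h), max_eq_left hx, max_eq_left (hx.trans h)]
    ring

/-- Capping the payment of an action at its index loses at most the excess over the index, by
`max_le_max_min_add`. The expected excess is at most the cost of the action, so paying the cost
outweighs the gain from removing the cap. -/
theorem value_le_cappedMax (hσ : ∀ i, I.IsIndex t i (σ i)) {π : Plan n m} {S : Finset (Fin n)}
    {R : Finset (Fin m)} (h : π.Legal S R) {v : ℝ} (hv : ∀ j ∈ R, t j ≤ v) :
    I.value t π ≤ I.cappedMax t σ Sᶜ v := by
  induction π generalizing S R v with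
  | halt j =>
    calc I.value t (.halt j) ≤ v := hv j h
      _ = I.expect fun _ => v := (I.expect_const v).symm
      _ ≤ _ := I.expect_mono fun X => Finset.le_fold_max v |>.2 (Or.inl le_rfl)
  | take i next ih =>
    have hi : i ∈ Sᶜ := Finset.mem_compl.2 h.1
    have h1 : ∀ j, I.value t (next j) ≤ (I.expect fun X =>
        max (min (t j) (σ i)) ((Sᶜ.erase i).fold max v fun k => min (t (X k)) (σ k)))
          + max (t j - σ i) 0 := by
      intro j
      have h2 := ih j (h.2 j) (v := max v (t j)) (fun l hl => by
        rcases Finset.mem_insert.1 hl with rfl | hl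
        · exact le_max_right _ _
        · exact (hv l hl).trans (le_max_left _ _))
      rw [Finset.compl_insert, cappedMax_max] at h2
      refine h2.trans ?_
      rw [← I.expect_const (max (t j - σ i) 0), ← I.expect_add]
      exact I.expect_mono fun X => max_le_max_min_add _ _ _
    rw [I.cappedMax_eq hi, value]
    have h3 : ∑ j, I.prob i j * I.value t (next j) ≤ _ :=
      Finset.sum_le_sum fun j _ => mul_le_mul_of_nonneg_left (h1 j) (I.prob_nonneg i j)
    simp only [mul_add, Finset.sum_add_distrib] at h3
    linarith [(hσ i).excess_le]

/-- The optimal plan takes the remaining action of largest index and halts once the best payment `v`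
reaches all remaining indices. Then all other capped payments and `v` are at most `σ i`, so
`max_eq_max_min_add` gives equality. As `0 ≤ v < σ i`, the index is positive and the expected excess
equals the cost. -/
theorem exists_value_eq_cappedMax (hσ : ∀ i, I.IsIndex t i (σ i)) (r : ℕ) :
    ∀ {S : Finset (Fin n)} {R : Finset (Fin m)} {j₀ : Fin m}, Sᶜ.card = r → j₀ ∈ R → ∀ {v : ℝ},
      0 ≤ v → t j₀ = v → ∃ π : Plan n m, π.Legal S R ∧ I.value t π = I.cappedMax t σ Sᶜ v := by
  induction r with
  | zero =>
    intro S R j₀ hc hj v hv0 hv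
    rw [Finset.card_eq_zero] at hc
    refine ⟨.halt j₀, hj, ?_⟩
    simp [value, hv, hc, cappedMax, I.expect_const]
  | succ r ih =>
    intro S R j₀ hc hj v hv0 hv
    obtain ⟨i, hi, himax⟩ := Finset.exists_max_image Sᶜ σ (Finset.card_pos.1 (by omega))
    rcases le_or_gt (σ i) v with hle | hlt
    · refine ⟨.halt j₀, hj, ?_⟩
      have : ∀ X : Fin n → Fin m, (Sᶜ.fold max v fun k => min (t (X k)) (σ k)) = v := fun X =>
        le_antisymm (Finset.fold_max_le v |>.2 ⟨le_rfl, fun k hk =>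
          (min_le_right _ _).trans ((himax k hk).trans hle)⟩)
          (Finset.le_fold_max v |>.2 (Or.inl le_rfl))
      simp [value, hv, cappedMax, this, I.expect_const]
    · have hcard : (insert i S)ᶜ.card = r := by
        rw [Finset.compl_insert, Finset.card_erase_of_mem hi, hc]; rfl
      have h1 : ∀ j, ∃ π : Plan n m, π.Legal (insert i S) (insert j R) ∧
          I.value t π = I.cappedMax t σ (insert i S)ᶜ (max v (t j)) := by
        intro j
        rcases le_total v (t j) with h | h
        · exact ih hcard (Finset.mem_insert_self j R) (hv0.trans (le_max_left _ _))
            (max_eq_right h).symm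
        · exact ih hcard (Finset.mem_insert_of_mem hj) (hv0.trans (le_max_left _ _))
            (hv.trans (max_eq_left h).symm)
      choose next hnext hval using h1
      refine ⟨.take i next, ⟨Finset.mem_compl.1 hi, hnext⟩, ?_⟩
      have h2 : ∀ j, I.value t (next j) = (I.expect fun X =>
          max (min (t j) (σ i)) ((Sᶜ.erase i).fold max v fun k => min (t (X k)) (σ k)))
            + max (t j - σ i) 0 := by
        intro j
        rw [hval, Finset.compl_insert, cappedMax_max, ← I.expect_const (max (t j - σ i) 0),
          ← I.expect_add]
        congr 1
        funext X
        refine max_eq_max_min_add (Finset.fold_max_le _ |>.2 ⟨hlt.le, fun k hk => ?_⟩)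
        exact (min_le_right _ _).trans (himax k (Finset.mem_of_mem_erase hk))
      rw [I.cappedMax_eq hi, value]
      simp only [h2, mul_add, Finset.sum_add_distrib]
      linarith [(hσ i).excess_le, (hσ i).le_excess (hv0.trans_lt hlt)]

theorem agentUtility_le_cappedMax (hσ : ∀ i, I.IsIndex t i (σ i)) (h0 : t 0 = 0) {π : Plan n m}
    (hπ : π.IsStrategy) : I.agentUtility t π ≤ I.cappedMax t σ Finset.univ 0 := by
  rw [I.agentUtility_eq_value t hπ]
  simpa using I.value_le_cappedMax hσ hπ (v := 0) (by simp [h0])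

theorem exists_agentUtility_eq_cappedMax (hσ : ∀ i, I.IsIndex t i (σ i)) (h0 : t 0 = 0) :
    ∃ π : Plan n m, π.IsStrategy ∧ I.agentUtility t π = I.cappedMax t σ Finset.univ 0 := by
  obtain ⟨π, hπ, hv⟩ := I.exists_value_eq_cappedMax hσ _ (S := ∅) (R := {0}) (j₀ := 0) rfl
    (by simp) le_rfl h0
  exact ⟨π, hπ, by rw [I.agentUtility_eq_value t hπ, hv]; simp⟩

end Search

/-! ### The expected maximum in polynomial size -/

/-- A maximum as a sum, by the first index that attains it. -/
theorem fold_max_eq_sum (g : Fin n → ℝ) (hg : ∀ i, 0 ≤ g i) :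
    Finset.univ.fold max 0 g = ∑ i, g i * ∏ k, (if k < i then (if g k < g i then 1 else 0)
      else if i < k then (if g i < g k then 0 else 1) else 1) := by
  rcases Nat.eq_zero_or_pos n with rfl | hn
  · simp
  have : NeZero n := ⟨hn.ne'⟩
  obtain ⟨a, -, ha⟩ := Finset.exists_max_image Finset.univ g ⟨0, Finset.mem_univ _⟩
  let A := Finset.univ.filter fun i => ∀ k, g k ≤ g i
  have hA : A.Nonempty := ⟨a, by simpa [A] using ha⟩
  have hmem : ∀ k, g k ≤ g (A.min' hA) := (Finset.mem_filter.1 (A.min'_mem hA)).2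
  have hmin : ∀ k, k < A.min' hA → g k < g (A.min' hA) := by
    intro k hk
    refine lt_of_le_of_ne (hmem k) fun e => ?_
    have : k ∈ A := by simpa [A, e] using hmem
    exact absurd (A.min'_le k this) (not_le.2 hk)
  set i := A.min' hA with hi
  rw [Finset.sum_eq_single i]
  · rw [Finset.prod_eq_one, mul_one]
    · exact le_antisymm (Finset.fold_max_le _ |>.2 ⟨hg i, fun k _ => hmem k⟩)
        (Finset.le_fold_max _ |>.2 (Or.inr ⟨i, Finset.mem_univ _, le_rfl⟩))
    · intro k _
      split_ifs with h1 h2 h3 h4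
      · rfl
      · exact absurd (hmin k h1) h2
      · exact absurd h4 (not_lt.2 (hmem k))
      · rfl
      · rfl
  · intro k _ hk
    rw [Finset.prod_eq_zero (Finset.mem_univ i), mul_zero]
    rcases lt_or_gt_of_ne hk with h | h
    · rw [if_neg (not_lt.2 h.le), if_pos h, if_pos (hmin k h)]
    · rw [if_pos h, if_neg (not_lt.2 (hmem k))]
  · simp

/-- Given `X i = j`, being the first maximizer is a conjunction of one condition per other action.
By independence its probability is a product, which replaces the sum over all `m ^ n` realizations.
-/
theorem expect_fold_max (κ : Fin n → Fin m → ℝ) (hκ : ∀ i j, 0 ≤ κ i j) :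
    I.expect (fun X => Finset.univ.fold max 0 fun i => κ i (X i))
      = ∑ i, ∑ j, I.prob i j * (κ i j * ∏ k,
        (if k < i then ∑ l, (if κ k l < κ i j then I.prob k l else 0)
          else if i < k then ∑ l, (if κ i j < κ k l then 0 else I.prob k l) else 1)) := by
  simp only [fold_max_eq_sum _ fun i => hκ i _, I.expect_sum]
  refine Finset.sum_congr rfl fun i _ => ?_
  rw [I.expect_split i (fun j X => κ i j * ∏ k, (if k < i then (if κ k (X k) < κ i j then 1 else 0)
      else if i < k then (if κ i j < κ k (X k) then 0 else 1) else 1))]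
  · refine Finset.sum_congr rfl fun j _ => ?_
    rw [I.expect_const_mul, I.expect_prod fun k l => if k < i then (if κ k l < κ i j then 1 else 0)
      else if i < k then (if κ i j < κ k l then 0 else 1) else 1]
    congr 2
    refine Finset.prod_congr rfl fun k _ => ?_
    split_ifs
    · simp
    · simp
    · simp [I.prob_sum]
  · intro j X l
    congr 1
    refine Finset.prod_congr rfl fun k _ => ?_
    rcases eq_or_ne k i with rfl | h
    · simp
    · rw [Function.update_of_ne h]

end Instance
end SeqContract

namespace SeqContract

/-! ### Linear contracts -/

namespace Instance

variable {n m : ℕ} [NeZero m] (I : Instance n m)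

/-- The cost of action `i`, extended by `0`. -/
noncomputable def costAt (i : ℕ) : ℝ := I.load.mem 0 i 0

/-- The reward of outcome `j`, extended by `0`. -/
noncomputable def rewardAt (j : ℕ) : ℝ := I.load.mem 1 j 0

/-- The probability that action `i` reveals outcome `j`, extended by `0`. -/
noncomputable def probAt (i j : ℕ) : ℝ := I.load.mem 2 i j

@[simp] theorem costAt_coe (i : Fin n) : I.costAt i = I.cost i := by
  simp [costAt, load]

@[simp] theorem rewardAt_coe (j : Fin m) : I.rewardAt j = I.reward j := by
  simp [rewardAt, load]

@[simp] theorem probAt_coe (i : Fin n) (j : Fin m) : I.probAt i j = I.prob i j := by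
  simp [probAt, load]

theorem rewardAt_zero : I.rewardAt 0 = 0 := by
  have := I.rewardAt_coe 0
  rwa [Fin.val_zero, I.reward_zero] at this

theorem rewardAt_nonneg (j : ℕ) : 0 ≤ I.rewardAt j := by
  by_cases h : j < m
  · simpa using (I.rewardAt_coe ⟨j, h⟩).symm ▸ I.reward_nonneg ⟨j, h⟩
  · simp [rewardAt, load, h]

theorem probAt_nonneg (i j : ℕ) : 0 ≤ I.probAt i j := by
  by_cases h : i < n ∧ j < m
  · simpa using (I.probAt_coe ⟨i, h.1⟩ ⟨j, h.2⟩).symm ▸ I.prob_nonneg ⟨i, h.1⟩ ⟨j, h.2⟩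
  · simp [probAt, load, h]

/-- The probability that the reward of action `i` is at least that of outcome `k`. -/
noncomputable def tailProb (i k : ℕ) : ℝ :=
  ∑ j ∈ Finset.range m, if I.rewardAt j < I.rewardAt k then 0 else I.probAt i j

/-- The expected reward of action `i`, restricted to rewards at least that of outcome `k`. -/
noncomputable def tailReward (i k : ℕ) : ℝ :=
  ∑ j ∈ Finset.range m,
    if I.rewardAt j < I.rewardAt k then 0 else I.probAt i j * I.rewardAt j

/-- The index of action `i` when the agent stops exactly at rewards at least that of `k`. -/
noncomputable def tailIndex (i k : ℕ) (α : ℝ) : ℝ :=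
  (α * I.tailReward i k - I.costAt i) / I.tailProb i k

/-- The nonnegative part of the index of action `i` under the linear contract. -/
noncomputable def index (i : ℕ) (α : ℝ) : ℝ := BigOp.max.fold (fun k => I.tailIndex i k α) m

theorem tailProb_nonneg (i k : ℕ) : 0 ≤ I.tailProb i k :=
  Finset.sum_nonneg fun j _ => by
    split_ifs
    · exact le_rfl
    · exact I.probAt_nonneg i j

theorem tail_excess (i k : ℕ) (α s : ℝ) : α * I.tailReward i k - s * I.tailProb i k
    = ∑ j : Fin m, if I.reward j < I.rewardAt k then 0
      else I.probAt i j * (α * I.reward j - s) := by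
  rw [tailReward, tailProb, Finset.sum_range, Finset.sum_range, Finset.mul_sum, Finset.mul_sum,
    ← Finset.sum_sub_distrib]
  refine Finset.sum_congr rfl fun j _ => ?_
  simp only [rewardAt_coe]
  split_ifs
  · ring
  · ring

theorem tailReward_eq_zero {i k : ℕ} (h : I.tailProb i k = 0) : I.tailReward i k = 0 := by
  rw [tailProb, Finset.sum_eq_zero_iff_of_nonneg] at h
  · refine Finset.sum_eq_zero fun j hj => ?_
    have := h j hj
    split_ifs at this ⊢
    · rfl
    · rw [this, zero_mul]
  · intro j _
    split_ifs
    · exact le_rfl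
    · exact I.probAt_nonneg i j

/-- For every threshold `k`, the sum of `p * (α * r - σ)` over rewards at least that of `k` is at
most the cost, because `σ` dominates `tailIndex i k α`. With `k` the least reward paying more than
`σ`, this sum is the whole expected excess. Conversely, a positive `σ` is attained at some `k`;
there the sum equals the cost, and replacing terms by positive parts only increases it. Thresholds
of probability `0` yield `0` by the division convention, which does not affect the maximum. -/
theorem isIndex_index {α : ℝ} (hα : 0 ≤ α) (i : Fin n) :
    I.IsIndex (I.linearContract α) i (I.index i α) := by
  have h0 : 0 ≤ I.index i α := BigOp.fold_max_nonneg _ _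
  have hle : ∀ k < m, I.tailIndex i k α ≤ I.index i α := fun k hk => BigOp.le_fold_max (fun k => I.tailIndex i k α) hk
  have htail : ∀ k < m, α * I.tailReward i k - I.index i α * I.tailProb i k ≤ I.cost i := by
    intro k hk
    rcases (I.tailProb_nonneg i k).eq_or_lt with h | h
    · rw [I.tailReward_eq_zero h.symm, ← h]
      simpa using I.cost_nonneg i
    · have h1 := hle k hk
      rw [tailIndex, div_le_iff₀ h, costAt_coe] at h1
      linarith
  refine ⟨h0, ?_, fun hpos => ?_⟩
  · by_cases hex : ∃ j : Fin m, I.index i α < α * I.reward j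
    · obtain ⟨k, hk, hmin⟩ := Finset.exists_min_image
        (Finset.univ.filter fun j : Fin m => I.index i α < α * I.reward j) I.reward
        (by obtain ⟨j, hj⟩ := hex; exact ⟨j, by simpa using hj⟩)
      rw [Finset.mem_filter] at hk
      refine le_of_eq_of_le ?_ (htail k k.2)
      rw [tail_excess]
      refine Finset.sum_congr rfl fun j _ => ?_
      simp only [linearContract, rewardAt_coe, probAt_coe]
      split_ifs with h
      · rw [max_eq_right, mul_zero]
        by_contra hc
        exact absurd (hmin j (Finset.mem_filter.2 ⟨Finset.mem_univ _, by linarith⟩)) (not_le.2 h)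
      · rw [max_eq_left]
        have := mul_le_mul_of_nonneg_left (not_lt.1 h) hα
        linarith [hk.2]
    · push Not at hex
      refine le_of_eq_of_le (Finset.sum_eq_zero fun j _ => ?_) (I.cost_nonneg i)
      rw [max_eq_right, mul_zero]
      simpa [linearContract] using hex j
  · rcases BigOp.fold_max_mem (fun k => I.tailIndex i k α) m with h | ⟨k, hk, h⟩
    · exact absurd h hpos.ne'
    · change I.index i α = I.tailIndex i k α at h
      have hne : I.tailProb i k ≠ 0 := by
        intro hz
        rw [h, tailIndex, hz, div_zero] at hpos
        exact lt_irrefl _ hpos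
      have h1 : I.cost i = α * I.tailReward i k - I.index i α * I.tailProb i k := by
        rw [h, tailIndex, div_mul_cancel₀ _ hne, costAt_coe]
        ring
      rw [h1, tail_excess]
      refine Finset.sum_le_sum fun j _ => ?_
      rw [probAt_coe]
      split_ifs
      · exact mul_nonneg (I.prob_nonneg i j) (le_max_right _ _)
      · exact mul_le_mul_of_nonneg_left (le_max_left _ _) (I.prob_nonneg i j)

/-- The payment for outcome `j`, capped at the index of action `i`. -/
noncomputable def capped (i j : ℕ) (α : ℝ) : ℝ :=
  if I.index i α < α * I.rewardAt j then I.index i α else α * I.rewardAt j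

/-- The conditional form of `capped` agrees definitionally with the value of the corresponding
expression; the minimum is what the search theory uses. -/
theorem capped_eq_min (i j : ℕ) (α : ℝ) :
    I.capped i j α = min (α * I.rewardAt j) (I.index i α) := by
  unfold capped
  split_ifs with h
  · exact (min_eq_right h.le).symm
  · exact (min_eq_left (not_lt.1 h)).symm

/-- The agent's optimal utility under the linear contract. -/
noncomputable def optUtility (α : ℝ) : ℝ :=
  ∑ i ∈ Finset.range n, ∑ j ∈ Finset.range m, I.probAt i j * (I.capped i j α *
    ∏ k ∈ Finset.range n,
      (if k < i then ∑ l ∈ Finset.range m,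
          (if I.capped k l α < I.capped i j α then I.probAt k l else 0)
        else if i < k then ∑ l ∈ Finset.range m,
          (if I.capped i j α < I.capped k l α then 0 else I.probAt k l) else 1))

theorem optUtility_eq_cappedMax {α : ℝ} (hα : 0 ≤ α) : I.optUtility α
    = I.cappedMax (I.linearContract α) (fun i => I.index i α) Finset.univ 0 := by
  have hκ : ∀ (i : Fin n) (j : Fin m), 0 ≤ I.capped i j α := fun i j => by
    rw [capped_eq_min]
    exact le_min (mul_nonneg hα (I.rewardAt_nonneg j)) (BigOp.fold_max_nonneg _ _)
  have h := I.expect_fold_max (fun i j => I.capped i j α) hκ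
  simp only [optUtility, Finset.sum_range, Finset.prod_range, probAt_coe, Fin.val_fin_lt]
  rw [← h]
  simp only [cappedMax, capped_eq_min, rewardAt_coe, linearContract]

theorem linearContract_zero (α : ℝ) : I.linearContract α 0 = 0 := by
  simp [linearContract, I.reward_zero]

theorem agentUtility_le_optUtility {α : ℝ} (hα : 0 ≤ α) {π : Plan n m} (hπ : π.IsStrategy) :
    I.agentUtility (I.linearContract α) π ≤ I.optUtility α := by
  rw [I.optUtility_eq_cappedMax hα]
  exact I.agentUtility_le_cappedMax (I.isIndex_index hα) (I.linearContract_zero α) hπ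

theorem agentOptimal_iff {α : ℝ} (hα : 0 ≤ α) (π : Plan n m) :
    I.AgentOptimal (I.linearContract α) π ↔
      π.IsStrategy ∧ I.agentUtility (I.linearContract α) π = I.optUtility α := by
  constructor
  · rintro ⟨h, h'⟩
    obtain ⟨π', hπ', hv⟩ :=
      I.exists_agentUtility_eq_cappedMax (I.isIndex_index hα) (I.linearContract_zero α)
    refine ⟨h, le_antisymm (I.agentUtility_le_optUtility hα h) ?_⟩
    rw [I.optUtility_eq_cappedMax hα, ← hv]
    exact h' π' hπ'
  · rintro ⟨h, h'⟩
    exact ⟨h, fun π' hπ' => h' ▸ I.agentUtility_le_optUtility hα hπ'⟩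

/-! ### The principal's utility as a slope -/

/-- The expected reward of a plan. -/
noncomputable def expectedReward (π : Plan n m) : ℝ :=
  I.expect fun X => I.reward (π.finalOutcome X)

/-- The expected cost of a plan. -/
noncomputable def expectedCost (π : Plan n m) : ℝ :=
  I.expect fun X => ∑ i ∈ π.actions X, I.cost i

theorem expectedReward_nonneg (π : Plan n m) : 0 ≤ I.expectedReward π :=
  (I.expect_const 0).symm.le.trans (I.expect_mono fun _ => I.reward_nonneg _)

theorem agentUtility_linearContract (α : ℝ) (π : Plan n m) :
    I.agentUtility (I.linearContract α) π = α * I.expectedReward π - I.expectedCost π := by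
  simp only [agentUtility, linearContract, expect_sub, expect_const_mul, expectedReward,
    expectedCost]

theorem principalUtilityOf_linearContract (α : ℝ) (π : Plan n m) :
    I.principalUtilityOf (I.linearContract α) π = (1 - α) * I.expectedReward π := by
  simp only [principalUtilityOf, linearContract, expect_sub, expect_const_mul, expectedReward]
  ring

theorem isBestResponse_bestResponse (t : Fin m → ℝ) : I.IsBestResponse t (I.bestResponse t) :=
  (I.exists_isBestResponse t).choose_spec

/-- Where the agent's optimal utility is affine, its slope is the expected reward of the best
response. -/
theorem principalUtility_of_affine {a b s c x : ℝ} (ha : 0 ≤ a) (hb : b ≤ 1)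
    (hU : ∀ y ∈ Set.Icc a b, I.optUtility y = s * y + c) (hax : a ≤ x) (hxb : x < b) :
    0 ≤ s ∧ I.principalUtility (I.linearContract x) = (1 - x) * s := by
  have hx0 : 0 ≤ x := ha.trans hax
  have hb0 : 0 ≤ b := hx0.trans hxb.le
  obtain ⟨hopt, hbest⟩ := I.isBestResponse_bestResponse (I.linearContract x)
  obtain ⟨hst, hval⟩ := (I.agentOptimal_iff hx0 _).1 hopt
  have hUx := hU x ⟨hax, hxb.le⟩
  have hUb := hU b ⟨hax.trans hxb.le, le_rfl⟩
  -- The utility line of the best response touches the optimal utility at `x` and stays below it at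
  -- `b > x`, so it is no steeper.
  have hle : I.expectedReward (I.bestResponse (I.linearContract x)) ≤ s := by
    have h1 := I.agentUtility_le_optUtility hb0 hst
    rw [agentUtility_linearContract] at h1 hval
    by_contra h
    nlinarith [mul_pos (sub_pos.2 hxb) (sub_pos.2 (not_le.1 h))]
  -- A response optimal at the midpoint has a utility line below the optimal utility at both ends
  -- and equal to it in between. It must coincide with it, so it has slope `s` and is already
  -- optimal at `x`; tie-breaking then yields the lower bound.
  obtain ⟨hopt', -⟩ := I.isBestResponse_bestResponse (I.linearContract ((x + b) / 2))
  set π := I.bestResponse (I.linearContract ((x + b) / 2))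
  have hy0 : 0 ≤ (x + b) / 2 := by linarith
  obtain ⟨hst', hval'⟩ := (I.agentOptimal_iff hy0 _).1 hopt'
  have hUy := hU ((x + b) / 2) ⟨by linarith, by linarith⟩
  have h1 := I.agentUtility_le_optUtility hx0 hst'
  have h2 := I.agentUtility_le_optUtility hb0 hst'
  rw [agentUtility_linearContract] at hval' h1 h2
  rw [hUy] at hval'
  have hs : I.expectedReward π = s := by
    have h3 : (b - x) * I.expectedReward π = (b - x) * s := by
      apply le_antisymm <;> linarith
    exact mul_left_cancel₀ (sub_pos.2 hxb).ne' h3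
  have hs0 : 0 ≤ s := hs ▸ I.expectedReward_nonneg π
  have hπ : I.AgentOptimal (I.linearContract x) π := by
    refine (I.agentOptimal_iff hx0 _).2 ⟨hst', ?_⟩
    rw [agentUtility_linearContract, hUx]
    rw [hs] at hval' ⊢
    linarith
  have h3 := hbest π hπ
  rw [principalUtilityOf_linearContract, hs] at h3
  refine ⟨hs0, le_antisymm ?_ h3⟩
  rw [principalUtility, principalUtilityOf_linearContract]
  exact mul_le_mul_of_nonneg_left hle (by linarith)

/-! ### The breakpoints of the agent's optimal utility -/

/-- The slopes of the lines of which the agent's optimal utility is made up: those of `tailIndex i k`,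
and, for lines with `tailProb i k = 0`, in particular for `i = n`, of the payment for outcome `k`. -/
noncomputable def lineSlope (i k : ℕ) : ℝ :=
  if 0 < I.tailProb i k then I.tailReward i k / I.tailProb i k else I.rewardAt k

/-- The form `0 - c` mirrors the expression language, which has subtraction but no negation. -/
noncomputable def lineConst (i k : ℕ) : ℝ :=
  if 0 < I.tailProb i k then (0 - I.costAt i) / I.tailProb i k else 0

/-- The crossing of two lines. -/
noncomputable def crossing (i k i' k' : ℕ) : ℝ :=
  (I.lineConst i' k' - I.lineConst i k) / (I.lineSlope i k - I.lineSlope i' k')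

/-- The crossing of two lines, moved into the unit interval. -/
noncomputable def breakpoint (i k i' k' : ℕ) : ℝ :=
  if I.crossing i k i' k' < 0 then 0
  else if 1 < I.crossing i k i' k' then 1 else I.crossing i k i' k'

theorem breakpoint_mem (i k i' k' : ℕ) : I.breakpoint i k i' k' ∈ Set.Icc (0 : ℝ) 1 := by
  unfold breakpoint
  split_ifs with h h'
  · simp
  · simp
  · exact ⟨not_lt.1 h, not_lt.1 h'⟩

/-- No two lines cross between `a` and `b`. -/
def NoBreakpoint (a b : ℝ) : Prop :=
  ∀ i < n + 1, ∀ k < m, ∀ i' < n + 1, ∀ k' < m, I.breakpoint i k i' k' ∉ Set.Ioo a b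

/-- On `[a, b]` the function `f` coincides with one of the lines. -/
def IsLineOn (a b : ℝ) (f : ℝ → ℝ) : Prop :=
  ∃ i < n + 1, ∃ k < m, ∀ x ∈ Set.Icc a b, f x = I.lineSlope i k * x + I.lineConst i k

variable {I} {a b : ℝ}

theorem tailProb_last (k : ℕ) : I.tailProb n k = 0 :=
  Finset.sum_eq_zero fun j _ => by simp [probAt, load]

theorem isLineOn_reward {j : ℕ} (hj : j < m) : I.IsLineOn a b fun x => x * I.rewardAt j :=
  ⟨n, by omega, j, hj, fun x _ => by simp [lineSlope, lineConst, tailProb_last, mul_comm]⟩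

theorem isLineOn_zero : I.IsLineOn a b fun _ => 0 := by
  simpa [rewardAt_zero] using isLineOn_reward (I := I) (a := a) (b := b) (NeZero.pos m)

theorem isLineOn_tailIndex {i k : ℕ} (hi : i < n) (hk : k < m) :
    I.IsLineOn a b (I.tailIndex i k) := by
  rcases (I.tailProb_nonneg i k).eq_or_lt with h | h
  · have : I.tailIndex i k = fun _ => 0 := by
      funext x
      rw [tailIndex, ← h, div_zero]
    rw [this]
    exact isLineOn_zero
  · refine ⟨i, by omega, k, hk, fun x _ => ?_⟩
    rw [lineSlope, lineConst, if_pos h, if_pos h, tailIndex]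
    ring

/-- Two affine functions that do not cross in `(a, b)` are ordered on `[a, b]`. -/
theorem affine_le_or_le {s t c d : ℝ}
    (h : (d - c) / (s - t) ∉ Set.Ioo a b) :
    (∀ x ∈ Set.Icc a b, s * x + c ≤ t * x + d) ∨ ∀ x ∈ Set.Icc a b, t * x + d ≤ s * x + c := by
  wlog hst : t ≤ s generalizing s t c d
  · refine (this (s := t) (t := s) (c := d) (d := c) ?_ (not_le.1 hst).le).symm
    rwa [← neg_sub d c, ← neg_sub s t, neg_div_neg_eq]
  rcases hst.eq_or_lt with rfl | hst
  · rcases le_total c d with h | h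
    · exact Or.inl fun x _ => by linarith
    · exact Or.inr fun x _ => by linarith
  have hpos : 0 < s - t := sub_pos.2 hst
  by_cases ha : a < (d - c) / (s - t)
  · have hb : b ≤ (d - c) / (s - t) := not_lt.1 fun hb => h ⟨ha, hb⟩
    refine Or.inl fun x hx => ?_
    have := (le_div_iff₀ hpos).1 (hx.2.trans hb)
    linarith
  · refine Or.inr fun x hx => ?_
    have := (div_le_iff₀ hpos).1 ((not_lt.1 ha).trans hx.1)
    linarith

theorem IsLineOn.le_or_le (hab : I.NoBreakpoint a b) (ha : 0 ≤ a) (hb : b ≤ 1) {f g : ℝ → ℝ}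
    (hf : I.IsLineOn a b f) (hg : I.IsLineOn a b g) :
    (∀ x ∈ Set.Icc a b, f x ≤ g x) ∨ ∀ x ∈ Set.Icc a b, g x ≤ f x := by
  obtain ⟨i, hi, k, hk, hf⟩ := hf
  obtain ⟨i', hi', k', hk', hg⟩ := hg
  have h : I.crossing i k i' k' ∉ Set.Ioo a b := by
    intro h
    refine hab i hi k hk i' hi' k' hk' ?_
    -- A crossing inside `(a, b)`, a part of `[0, 1]`, is not changed by clamping.
    rwa [breakpoint, if_neg (by linarith [h.1]), if_neg (by linarith [h.2])]
  refine (affine_le_or_le h).imp (fun h x hx => ?_) (fun h x hx => ?_)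
  · rw [hf x hx, hg x hx]; exact h x hx
  · rw [hf x hx, hg x hx]; exact h x hx

theorem IsLineOn.congr {f g : ℝ → ℝ} (hf : I.IsLineOn a b f) (h : ∀ x ∈ Set.Icc a b, g x = f x) :
    I.IsLineOn a b g := by
  obtain ⟨i, hi, k, hk, hf⟩ := hf
  exact ⟨i, hi, k, hk, fun x hx => (h x hx).trans (hf x hx)⟩

/-- Without crossings the lines are totally ordered on `[a, b]`, so the family is closed under
maxima and minima and no new lines arise. -/
theorem IsLineOn.max (hab : I.NoBreakpoint a b) (ha : 0 ≤ a) (hb : b ≤ 1) {f g : ℝ → ℝ}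
    (hf : I.IsLineOn a b f) (hg : I.IsLineOn a b g) : I.IsLineOn a b fun x => max (f x) (g x) := by
  rcases hf.le_or_le hab ha hb hg with h | h
  · exact hg.congr fun x hx => max_eq_right (h x hx)
  · exact hf.congr fun x hx => max_eq_left (h x hx)

theorem IsLineOn.min (hab : I.NoBreakpoint a b) (ha : 0 ≤ a) (hb : b ≤ 1) {f g : ℝ → ℝ}
    (hf : I.IsLineOn a b f) (hg : I.IsLineOn a b g) : I.IsLineOn a b fun x => min (f x) (g x) := by
  rcases hf.le_or_le hab ha hb hg with h | h
  · exact hf.congr fun x hx => min_eq_left (h x hx)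
  · exact hg.congr fun x hx => min_eq_right (h x hx)

theorem isLineOn_index (hab : I.NoBreakpoint a b) (ha : 0 ≤ a) (hb : b ≤ 1) {i : ℕ} (hi : i < n) :
    I.IsLineOn a b (I.index i) := by
  have : ∀ N ≤ m, I.IsLineOn a b fun α => BigOp.max.fold (fun k => I.tailIndex i k α) N := by
    intro N hN
    induction N with
    | zero => exact isLineOn_zero
    | succ N ih => exact (ih (by omega)).max hab ha hb (isLineOn_tailIndex hi (by omega))
  exact this m le_rfl

/-- For each realization the capped maximum is one of the lines, and an expectation of affine
functions is affine. The line may vary with the realization, but the breakpoints do not. -/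
theorem exists_optUtility_eq (hab : I.NoBreakpoint a b) (ha : 0 ≤ a) (hb : b ≤ 1) :
    ∃ s c : ℝ, ∀ x ∈ Set.Icc a b, I.optUtility x = s * x + c := by
  have h : ∀ X : Fin n → Fin m, I.IsLineOn a b fun α => Finset.univ.fold Max.max 0 fun i =>
      Min.min (α * I.rewardAt (X i)) (I.index i α) := by
    intro X
    induction (Finset.univ : Finset (Fin n)) using Finset.induction_on with
    | empty => exact isLineOn_zero
    | insert i T hi ih =>
      simp only [Finset.fold_insert hi]
      exact ((isLineOn_reward (X i).2).min hab ha hb (isLineOn_index hab ha hb i.2)).max hab ha hb ih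
  choose i _ k _ h using h
  refine ⟨I.expect fun X => I.lineSlope (i X) (k X), I.expect fun X => I.lineConst (i X) (k X),
    fun x hx => ?_⟩
  rw [I.optUtility_eq_cappedMax (ha.trans hx.1), mul_comm, ← I.expect_const_mul, ← I.expect_add,
    cappedMax]
  congr 1
  funext X
  have := h X x hx
  simp only [rewardAt_coe] at this
  simp only [linearContract]
  rw [this, mul_comm]

variable (I)

/-! ### The optimal parameter -/

/-- The maximum of `f` over all pairs of lines, or `0`. -/
noncomputable def maxPairs (n m : ℕ) (f : ℕ → ℕ → ℕ → ℕ → ℝ) : ℝ :=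
  BigOp.max.fold (fun i => BigOp.max.fold (fun k => BigOp.max.fold (fun i' =>
    BigOp.max.fold (fun k' => f i k i' k') m) (n + 1)) m) (n + 1)


/-- The least breakpoint above `α`, or `1`. -/
noncomputable def nextBreakpoint (α : ℝ) : ℝ :=
  1 - maxPairs n m fun i k i' k' =>
    if α < I.breakpoint i k i' k' then 1 - I.breakpoint i k i' k' else 0

/-- The principal's utility, from the slope of the agent's optimal utility to the right of `α`. -/
noncomputable def slopeUtility (α : ℝ) : ℝ :=
  (1 - α) * ((I.optUtility (I.nextBreakpoint α) - I.optUtility α) / (I.nextBreakpoint α - α))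

noncomputable def maxUtility : ℝ :=
  maxPairs n m fun i k i' k' => I.slopeUtility (I.breakpoint i k i' k')

/-- Non-maximizers contribute the neutral value `0`, so this is the largest maximizing breakpoint.
-/
noncomputable def optParam : ℝ :=
  maxPairs n m fun i k i' k' =>
    if I.slopeUtility (I.breakpoint i k i' k') < I.maxUtility then 0 else I.breakpoint i k i' k'

theorem maxPairs_nonneg (n m : ℕ) (f : ℕ → ℕ → ℕ → ℕ → ℝ) : 0 ≤ maxPairs n m f :=
  BigOp.fold_max_nonneg _ _

theorem le_maxPairs {n m : ℕ} (f : ℕ → ℕ → ℕ → ℕ → ℝ) {i k i' k' : ℕ} (hi : i < n + 1) (hk : k < m)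
    (hi' : i' < n + 1) (hk' : k' < m) : f i k i' k' ≤ maxPairs n m f :=
  (BigOp.le_fold_max (fun k' => f i k i' k') hk').trans <|
    (BigOp.le_fold_max (fun i' => BigOp.max.fold (fun k' => f i k i' k') m) hi').trans <|
    (BigOp.le_fold_max (fun k => BigOp.max.fold (fun i' =>
      BigOp.max.fold (fun k' => f i k i' k') m) (n + 1)) hk).trans <|
    BigOp.le_fold_max (fun i => BigOp.max.fold (fun k => BigOp.max.fold (fun i' =>
      BigOp.max.fold (fun k' => f i k i' k') m) (n + 1)) m) hi

theorem maxPairs_mem (n m : ℕ) (f : ℕ → ℕ → ℕ → ℕ → ℝ) : maxPairs n m f = 0 ∨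
    ∃ i < n + 1, ∃ k < m, ∃ i' < n + 1, ∃ k' < m, maxPairs n m f = f i k i' k' := by
  unfold maxPairs
  obtain h | ⟨i, hi, h⟩ := BigOp.fold_max_mem (fun i => BigOp.max.fold (fun k =>
    BigOp.max.fold (fun i' => BigOp.max.fold (fun k' => f i k i' k') m) (n + 1)) m) (n + 1)
  · exact Or.inl h
  rw [h]
  obtain h | ⟨k, hk, h⟩ := BigOp.fold_max_mem (fun k =>
    BigOp.max.fold (fun i' => BigOp.max.fold (fun k' => f i k i' k') m) (n + 1)) m
  · exact Or.inl h
  rw [h]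
  obtain h | ⟨i', hi', h⟩ := BigOp.fold_max_mem (fun i' =>
    BigOp.max.fold (fun k' => f i k i' k') m) (n + 1)
  · exact Or.inl h
  rw [h]
  obtain h | ⟨k', hk', h⟩ := BigOp.fold_max_mem (fun k' => f i k i' k') m
  · exact Or.inl h
  exact Or.inr ⟨i, hi, k, hk, i', hi', k', hk', h⟩

/-- Division by zero makes the left endpoint `0` a breakpoint, so every parameter has a breakpoint
at or below it. -/
theorem breakpoint_self (i k : ℕ) : I.breakpoint i k i k = 0 := by
  simp [breakpoint, crossing]

/-- Maxima start at `0`, so a minimum in `[0, 1]` is taken as `1` minus a maximum of complements; if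
no breakpoint lies beyond `α`, the default is `1`. -/
theorem nextBreakpoint_spec {α : ℝ} (hα : α < 1) : α < I.nextBreakpoint α ∧ I.nextBreakpoint α ≤ 1 ∧
    I.NoBreakpoint α (I.nextBreakpoint α) ∧ (I.nextBreakpoint α = 1 ∨ ∃ i < n + 1, ∃ k < m,
      ∃ i' < n + 1, ∃ k' < m, I.nextBreakpoint α = I.breakpoint i k i' k') := by
  set f : ℕ → ℕ → ℕ → ℕ → ℝ := fun i k i' k' =>
    if α < I.breakpoint i k i' k' then 1 - I.breakpoint i k i' k' else 0 with hf
  have hnb : I.nextBreakpoint α = 1 - maxPairs n m f := rfl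
  have hle : I.nextBreakpoint α ≤ 1 := by linarith [maxPairs_nonneg n m f]
  have hno : I.NoBreakpoint α (I.nextBreakpoint α) := by
    intro i hi k hk i' hi' k' hk' h
    have h1 := le_maxPairs f hi hk hi' hk'
    simp only [hf, if_pos h.1] at h1
    linarith [h.2]
  have h0 : ∀ h : maxPairs n m f = 0, I.nextBreakpoint α = 1 := fun h => by rw [hnb, h, sub_zero]
  rcases maxPairs_mem n m f with h | ⟨i, hi, k, hk, i', hi', k', hk', h⟩
  · exact ⟨by rwa [h0 h], hle, hno, Or.inl (h0 h)⟩
  · by_cases hc : α < I.breakpoint i k i' k'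
    · simp only [hf, if_pos hc] at h
      have h1 : I.nextBreakpoint α = I.breakpoint i k i' k' := by
        rw [hnb, h]; ring
      exact ⟨by rwa [h1], hle, hno, Or.inr ⟨i, hi, k, hk, i', hi', k', hk', h1⟩⟩
    · have h : maxPairs n m f = 0 := by rw [h]; simp only [hf, if_neg hc]
      exact ⟨by rwa [h0 h], hle, hno, Or.inl (h0 h)⟩

theorem principalUtility_one : I.principalUtility (I.linearContract 1) = 0 := by
  rw [principalUtility, principalUtilityOf_linearContract, sub_self, zero_mul]

/-- Up to the next breakpoint the optimal utility is affine, so its difference quotient is the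
slope. At `α = 1` the factor `1 - α` makes the degenerate quotient irrelevant. -/
theorem slopeUtility_eq {α : ℝ} (hα : α ∈ Set.Icc (0 : ℝ) 1) :
    I.slopeUtility α = I.principalUtility (I.linearContract α) := by
  rcases hα.2.eq_or_lt with rfl | h1
  · rw [I.principalUtility_one, slopeUtility, sub_self, zero_mul]
  · obtain ⟨hlt, hle, hno, -⟩ := I.nextBreakpoint_spec h1
    obtain ⟨s, c, hU⟩ := exists_optUtility_eq hno hα.1 hle
    rw [(I.principalUtility_of_affine hα.1 hle hU le_rfl hlt).2, slopeUtility,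
      hU _ ⟨le_rfl, hlt.le⟩, hU _ ⟨hlt.le, le_rfl⟩]
    congr 1
    rw [div_eq_iff (sub_pos.2 hlt).ne']
    ring

/-- With `α` the last breakpoint up to `x`, both parameters lie on the same affine piece of slope `s
≥ 0`, and `(1 - x) * s ≤ (1 - α) * s`. The piece is half-open, so `x = 1` is treated separately. -/
theorem exists_breakpoint_ge {x : ℝ} (hx : x ∈ Set.Icc (0 : ℝ) 1) :
    ∃ i < n + 1, ∃ k < m, ∃ i' < n + 1, ∃ k' < m, I.principalUtility (I.linearContract x)
      ≤ I.slopeUtility (I.breakpoint i k i' k') := by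
  have hm := NeZero.pos m
  let A := ((Finset.range (n + 1) ×ˢ Finset.range m) ×ˢ (Finset.range (n + 1) ×ˢ Finset.range m)).filter
    fun q => I.breakpoint q.1.1 q.1.2 q.2.1 q.2.2 ≤ x
  have hA : A.Nonempty :=
    ⟨((n, 0), (n, 0)), by simp [A, hm, breakpoint_self, hx.1]⟩
  obtain ⟨⟨⟨i, k⟩, i', k'⟩, hq, hmax⟩ :=
    Finset.exists_max_image A (fun q => I.breakpoint q.1.1 q.1.2 q.2.1 q.2.2) hA
  simp only [A, Finset.mem_filter, Finset.mem_product, Finset.mem_range, Prod.forall] at hq hmax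
  obtain ⟨⟨⟨hi, hk⟩, hi', hk'⟩, hqx⟩ := hq
  refine ⟨i, hi, k, hk, i', hi', k', hk', ?_⟩
  have hmem := I.breakpoint_mem i k i' k'
  set α := I.breakpoint i k i' k'
  rw [I.slopeUtility_eq hmem]
  rcases hmem.2.eq_or_lt with h1 | h1
  · rw [h1, show x = 1 from le_antisymm hx.2 (h1 ▸ hqx)]
  obtain ⟨hlt, hle, hno, hcase⟩ := I.nextBreakpoint_spec h1
  obtain ⟨s, c, hU⟩ := exists_optUtility_eq hno hmem.1 hle
  obtain ⟨hs, hα⟩ := I.principalUtility_of_affine hmem.1 hle hU le_rfl hlt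
  rw [hα]
  rcases hx.2.eq_or_lt with rfl | hx1
  · rw [I.principalUtility_one]
    exact mul_nonneg (by linarith) hs
  have hxlt : x < I.nextBreakpoint α := by
    rcases hcase with h | ⟨p, hp, q, hq, p', hp', q', hq', h⟩
    · rwa [h]
    · by_contra hc
      have := hmax p q p' q' ⟨⟨⟨hp, hq⟩, hp', hq'⟩, h ▸ not_lt.1 hc⟩
      linarith
  rw [(I.principalUtility_of_affine hmem.1 hle hU hqx hxlt).2]
  exact mul_le_mul_of_nonneg_right (by linarith) hs

theorem isOptimalLinear_optParam : I.IsOptimalLinear I.optParam := by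
  have hm := NeZero.pos m
  have hge : ∀ i < n + 1, ∀ k < m, ∀ i' < n + 1, ∀ k' < m,
      I.slopeUtility (I.breakpoint i k i' k') ≤ I.maxUtility := fun i hi k hk i' hi' k' hk' =>
    le_maxPairs (fun i k i' k' => I.slopeUtility (I.breakpoint i k i' k')) hi hk hi' hk'
  suffices h : I.optParam ∈ Set.Icc (0 : ℝ) 1 ∧ I.maxUtility ≤ I.slopeUtility I.optParam by
    refine ⟨h.1, fun x hx => ?_⟩
    rw [← I.slopeUtility_eq h.1]
    obtain ⟨i, hi, k, hk, i', hi', k', hk', hle⟩ := I.exists_breakpoint_ge hx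
    exact hle.trans ((hge i hi k hk i' hi' k' hk').trans h.2)
  set f : ℕ → ℕ → ℕ → ℕ → ℝ := fun i k i' k' =>
    if I.slopeUtility (I.breakpoint i k i' k') < I.maxUtility then 0
    else I.breakpoint i k i' k' with hf
  have hopt : I.optParam = maxPairs n m f := rfl
  -- The value `0` may come from a default rather than from a maximizer. It is optimal nonetheless:
  -- either the maximal utility is `0`, or a maximizing breakpoint is at most `optParam = 0`.
  have hzero : I.optParam = 0 → I.optParam ∈ Set.Icc (0 : ℝ) 1 ∧
      I.maxUtility ≤ I.slopeUtility I.optParam := by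
    intro h0
    refine ⟨by simp [h0], ?_⟩
    obtain hV | ⟨i, hi, k, hk, i', hi', k', hk', hV⟩ :=
      maxPairs_mem n m fun i k i' k' => I.slopeUtility (I.breakpoint i k i' k')
    · rw [maxUtility, hV, h0, I.slopeUtility_eq (by simp), principalUtility,
        principalUtilityOf_linearContract]
      simpa using I.expectedReward_nonneg _
    · change I.maxUtility = _ at hV
      have h1 := le_maxPairs f hi hk hi' hk'
      rw [← hopt, h0] at h1
      simp only [hf, hV, lt_irrefl, if_false] at h1
      have h2 : I.breakpoint i k i' k' = 0 := le_antisymm h1 (I.breakpoint_mem i k i' k').1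
      rw [hV, h2, h0]
  obtain h | ⟨i, hi, k, hk, i', hi', k', hk', h⟩ := maxPairs_mem n m f
  · exact hzero h
  · by_cases hc : I.slopeUtility (I.breakpoint i k i' k') < I.maxUtility
    · exact hzero (by rw [hopt, h]; simp only [hf, if_pos hc])
    · have h1 : I.optParam = I.breakpoint i k i' k' := by
        rw [hopt, h]; simp only [hf, if_neg hc]
      rw [h1]
      exact ⟨I.breakpoint_mem i k i' k', not_lt.1 hc⟩

end Instance
end SeqContract

namespace SeqContract

/-! ### The optimal parameter as an expression -/

namespace Expr

open Function (update)

/-- The maximum of `e` over all pairs `(i, k)`, `(i', k')` of lines. -/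
def maxPairs (i k i' k' : ℕ) (e : Expr) : Expr :=
  big .max .actsSucc i (big .max .outs k (big .max .actsSucc i' (big .max .outs k' e)))

/-- Bound variables are assigned by level to avoid capture: `0`–`3` for the outer maxima, `4`–`7`
for the next breakpoint, `8`–`11` for the optimal utility, `12` and `13` for indices and tails. -/
def tailProb (i k : ℕ) : Expr :=
  big .sum .outs 13 (ifLt (reward 13) (reward k) zero (prob i 13))

def tailReward (i k : ℕ) : Expr :=
  big .sum .outs 13 (ifLt (reward 13) (reward k) zero (bin .mul (prob i 13) (reward 13)))

def index (i : ℕ) (α : Expr) : Expr :=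
  big .max .outs 12
    (bin .div (bin .sub (bin .mul α (tailReward i 12)) (cost i)) (tailProb i 12))

def capped (i j : ℕ) (α : Expr) : Expr :=
  ifLt (index i α) (bin .mul α (reward j)) (index i α) (bin .mul α (reward j))

def optUtility (α : Expr) : Expr :=
  big .sum .acts 8 (big .sum .outs 9 (bin .mul (prob 8 9) (bin .mul (capped 8 9 α)
    (big .prod .acts 10
      (ifIdxLt 10 8
        (big .sum .outs 11 (ifLt (capped 10 11 α) (capped 8 9 α) (prob 10 11) zero))
        (ifIdxLt 8 10
          (big .sum .outs 11 (ifLt (capped 8 9 α) (capped 10 11 α) zero (prob 10 11)))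
          one))))))

def lineSlope (i k : ℕ) : Expr :=
  ifLt zero (tailProb i k) (bin .div (tailReward i k) (tailProb i k)) (reward k)

def lineConst (i k : ℕ) : Expr :=
  ifLt zero (tailProb i k) (bin .div (bin .sub zero (cost i)) (tailProb i k)) zero

def crossing (i k i' k' : ℕ) : Expr :=
  bin .div (bin .sub (lineConst i' k') (lineConst i k))
    (bin .sub (lineSlope i k) (lineSlope i' k'))

def breakpoint (i k i' k' : ℕ) : Expr :=
  ifLt (crossing i k i' k') zero zero
    (ifLt one (crossing i k i' k') one (crossing i k i' k'))

def nextBreakpoint (α : Expr) : Expr :=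
  bin .sub one (maxPairs 4 5 6 7
    (ifLt α (breakpoint 4 5 6 7) (bin .sub one (breakpoint 4 5 6 7)) zero))

def slopeUtility (α : Expr) : Expr :=
  bin .mul (bin .sub one α)
    (bin .div (bin .sub (optUtility (nextBreakpoint α)) (optUtility α))
      (bin .sub (nextBreakpoint α) α))

/-- This expression is closed, so it may rebind `0`–`3` inside `optParam`. Recomputing it in every
round costs only a polynomial factor. -/
def maxUtility : Expr := maxPairs 0 1 2 3 (slopeUtility (breakpoint 0 1 2 3))

def optParam : Expr :=
  maxPairs 0 1 2 3
    (ifLt (slopeUtility (breakpoint 0 1 2 3)) maxUtility zero (breakpoint 0 1 2 3))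

/-! ### Values of the expressions -/

variable {n m : ℕ} [NeZero m] {I : Instance n m} {ρ : ℕ → ℕ}

/-- The value of `e` is `a`, whatever the variables from `d` on are. -/
def HasValue (I : Instance n m) (d : ℕ) (e : Expr) (ρ : ℕ → ℕ) (a : ℝ) : Prop :=
  ∀ ρ', (∀ x < d, ρ' x = ρ x) → e.eval I ρ' = a

theorem HasValue.eval {d : ℕ} {e : Expr} {a : ℝ} (h : HasValue I d e ρ a) : e.eval I ρ = a :=
  h ρ fun _ _ => rfl

theorem HasValue.mono {d d' : ℕ} {e : Expr} {a : ℝ} (h : HasValue I d e ρ a) (hd : d ≤ d') :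
    HasValue I d' e ρ a :=
  fun ρ' hρ' => h ρ' fun x hx => hρ' x (by omega)

theorem HasValue.update {d : ℕ} {e : Expr} {a : ℝ} (h : HasValue I d e ρ a) {x : ℕ} (hx : d ≤ x)
    (v : ℕ) : HasValue I d e (update ρ x v) a :=
  fun ρ' hρ' => h ρ' fun y hy => by rw [hρ' y hy, Function.update_of_ne (by omega)]

theorem eval_maxPairs {i k i' k' : ℕ} (e : Expr) : (maxPairs i k i' k' e).eval I ρ
    = Instance.maxPairs n m fun p q p' q' =>
      e.eval I (update (update (update (update ρ i p) k q) i' p') k' q') :=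
  rfl

theorem eval_tailProb {i k : ℕ} (hi : i ≠ 13) (hk : k ≠ 13) :
    (tailProb i k).eval I ρ = I.tailProb (ρ i) (ρ k) := by
  simp only [tailProb, eval, BigOp.fold_sum, Function.update_self, Function.update_of_ne hi,
    Function.update_of_ne hk]
  rfl

theorem eval_tailReward {i k : ℕ} (hi : i ≠ 13) (hk : k ≠ 13) :
    (tailReward i k).eval I ρ = I.tailReward (ρ i) (ρ k) := by
  simp only [tailReward, eval, BigOp.fold_sum, Function.update_self, Function.update_of_ne hi,
    Function.update_of_ne hk]
  rfl

theorem eval_index {i : ℕ} (hi : i < 12) {α : Expr} {a : ℝ} (hα : HasValue I 8 α ρ a) :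
    (index i α).eval I ρ = I.index (ρ i) a := by
  have h12 : i ≠ 12 := by omega
  simp only [index, eval, eval_tailProb (by omega : i ≠ 13) (by norm_num : 12 ≠ 13),
    eval_tailReward (by omega : i ≠ 13) (by norm_num : 12 ≠ 13), Function.update_self,
    Function.update_of_ne h12, (hα.update (by norm_num : 8 ≤ 12) _).eval]
  rfl

theorem eval_capped {i j : ℕ} (hi : i < 12) {α : Expr} {a : ℝ} (hα : HasValue I 8 α ρ a) :
    (capped i j α).eval I ρ = I.capped (ρ i) (ρ j) a := by
  simp only [capped, eval, eval_index hi hα, hα.eval]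
  rfl

theorem eval_optUtility {α : Expr} {a : ℝ} (hα : HasValue I 8 α ρ a) :
    (optUtility α).eval I ρ = I.optUtility a := by
  have h9 : ∀ i j, HasValue I 8 α (update (update ρ 8 i) 9 j) a := fun i j =>
    (hα.update le_rfl i).update (by norm_num) j
  have h10 : ∀ i j k, HasValue I 8 α (update (update (update ρ 8 i) 9 j) 10 k) a := fun i j k =>
    (h9 i j).update (by norm_num) k
  have h11 : ∀ i j k l,
      HasValue I 8 α (update (update (update (update ρ 8 i) 9 j) 10 k) 11 l) a := fun i j k l =>
    (h10 i j k).update (by norm_num) l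
  simp only [optUtility, eval, BigOp.fold_sum, BigOp.fold_prod,
    eval_capped (by norm_num : 8 < 12) (h9 _ _), eval_capped (by norm_num : 8 < 12) (h11 _ _ _ _),
    eval_capped (by norm_num : 10 < 12) (h11 _ _ _ _)]
  rfl

theorem eval_breakpoint {i k i' k' : ℕ} (hi : i ≠ 13) (hk : k ≠ 13) (hi' : i' ≠ 13) (hk' : k' ≠ 13) :
    (breakpoint i k i' k').eval I ρ = I.breakpoint (ρ i) (ρ k) (ρ i') (ρ k') := by
  simp only [breakpoint, crossing, lineSlope, lineConst, eval, eval_tailProb hi hk,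
    eval_tailProb hi' hk', eval_tailReward hi hk, eval_tailReward hi' hk']
  rfl

/-- Variables `4`–`7` are rebound inside, so the result again depends only on those below `4` and
can be substituted into `optUtility`. -/
theorem hasValue_nextBreakpoint {α : Expr} {a : ℝ} (hα : HasValue I 4 α ρ a) :
    HasValue I 4 (nextBreakpoint α) ρ (I.nextBreakpoint a) := by
  intro ρ' hρ'
  have h7 : ∀ p q p' q',
      HasValue I 4 α (update (update (update (update ρ' 4 p) 5 q) 6 p') 7 q') a := by
    intro p q p' q' ρ'' hρ''
    refine hα ρ'' fun x hx => ?_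
    rw [hρ'' x hx, Function.update_of_ne (by omega), Function.update_of_ne (by omega),
      Function.update_of_ne (by omega), Function.update_of_ne (by omega), hρ' x hx]
  simp only [nextBreakpoint, eval, eval_maxPairs, (h7 _ _ _ _).eval,
    eval_breakpoint (by norm_num : 4 ≠ 13) (by norm_num : 5 ≠ 13) (by norm_num : 6 ≠ 13)
      (by norm_num : 7 ≠ 13)]
  rfl

theorem eval_slopeUtility {α : Expr} {a : ℝ} (hα : HasValue I 4 α ρ a) :
    (slopeUtility α).eval I ρ = I.slopeUtility a := by
  have hn := hasValue_nextBreakpoint hα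
  simp only [slopeUtility, eval, eval_optUtility (hα.mono (by norm_num)),
    eval_optUtility (hn.mono (by norm_num)), hα.eval, hn.eval]
  rfl

theorem hasValue_breakpoint : HasValue I 4 (breakpoint 0 1 2 3) ρ
    (I.breakpoint (ρ 0) (ρ 1) (ρ 2) (ρ 3)) := by
  intro ρ' hρ'
  rw [eval_breakpoint (by norm_num) (by norm_num) (by norm_num) (by norm_num),
    hρ' 0 (by norm_num), hρ' 1 (by norm_num), hρ' 2 (by norm_num), hρ' 3 (by norm_num)]

theorem eval_maxUtility : maxUtility.eval I ρ = I.maxUtility := by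
  simp only [maxUtility, eval_maxPairs, eval_slopeUtility hasValue_breakpoint]
  rfl

theorem eval_optParam : optParam.eval I ρ = I.optParam := by
  simp only [optParam, eval_maxPairs, eval, eval_slopeUtility hasValue_breakpoint,
    hasValue_breakpoint.eval, eval_maxUtility]
  rfl

end Expr
end SeqContract

/-- There are one program and constants `C`, `k` such that on every instance with `n` independent
actions and `m` outcomes the program halts within `C * (n + m) ^ k` steps and outputs an optimal
`α`; moreover, if the numbers of the instance are rational with at most `L` bits, all numbers
written during the run are rational with at most `C * (n + m + L) ^ k` bits. -/
theorem theorem3p1 :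
    ∃ (prog : SeqContract.Cmd) (C k : ℕ),
      ∀ (n m : ℕ) [NeZero m] (I : SeqContract.Instance n m),
        ∃ (T : ℕ) (s : SeqContract.State),
          SeqContract.Exec
            (fun x => ∀ L : ℕ, I.BitsLE L → SeqContract.BitsLE (C * (n + m + L) ^ k) x)
            prog I.load T s ∧
          T ≤ C * (n + m) ^ k ∧
          I.IsOptimalLinear s.output := by
  obtain ⟨prog, C, k, h⟩ := SeqContract.Expr.exists_program SeqContract.Expr.optParam
  refine ⟨prog, C, k, fun n m _ I => ?_⟩
  obtain ⟨T, s, hex, hT, hs⟩ := h n m I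
  refine ⟨T, s, hex, hT, ?_⟩
  rw [hs, SeqContract.Expr.eval_optParam]
  exact I.isOptimalLinear_optParam
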